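/- Let $k$ be a commutative unital ring; algebras are associative $k$-algebras, not necessarily unital. For $k$-submodules $S,T$ of an algebra, $ST$ denotes the $k$-span of all products $st$ with $s\in S$, $t\in T$. A ring $R$ is $s$-unital if for every $r\in R$ there are $y,z\in R$ with $yr=r=rz$. A multiplier of an algebra $\mathcal I$ is a pair $w=(R,L)$ of $k$-linear maps $\mathcal I\to\mathcal I$, written $aw=R(a)$ and $wa=L(a)$, with $(ab)w=a(bw)$, $w(ab)=(wa)b$ and $(aw)b=a(wb)$ for all $a,b\in\mathcal I$; multipliers form a monoid $\mathcal M(\mathcal I)$ under $a(ww')=(aw)w'$, $(ww')a=w(w'a)$. A twisted partial action $\Theta$ of a group $G$ on an algebra $\mathcal A$ consists of two-sided ideals $\mathcal D_g$ of $\mathcal A$ and algebra isomorphisms $\theta_g:\mathcal D_{g^{-1}}\to\mathcal D_g$ ($g\in G$) and invertible elements $w_{g,h}\in\mathcal M(\mathcal D_g\mathcal D_{gh})$ ($g,h\in G$) such that for all $g,h,t\in G$: (1) $\mathcal D_g^2=\mathcal D_g$ and $\mathcal D_g\mathcal D_h=\mathcal D_h\mathcal D_g$; (2) $\mathcal D_1=\mathcal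 A$ and $\theta_1=\mathrm{id}_{\mathcal A}$; (3) $\theta_g(\mathcal D_{g^{-1}}\mathcal D_h)=\mathcal D_g\mathcal D_{gh}$; (4) $\theta_g(\theta_h(a))=w_{g,h}\,\theta_{gh}(a)\,w_{g,h}^{-1}$ for all $a\in\mathcal D_{h^{-1}}\mathcal D_{h^{-1}g^{-1}}$; (5) $w_{1,g}=w_{g,1}=1$; (6) $\theta_g(a\,w_{h,t})\,w_{g,ht}=\theta_g(a)\,w_{g,h}\,w_{gh,t}$ for all $a\in\mathcal D_{g^{-1}}\mathcal D_h\mathcal D_{ht}$. Its crossed product is the $G$-graded algebra $\bigoplus_{g\in G}\mathcal D_g\delta_g$ with multiplication $(a\delta_g)(b\delta_h)=\theta_g(\theta_g^{-1}(a)\,b)\,w_{g,h}\,\delta_{gh}$ for $a\in\mathcal D_g$, $b\in\mathcal D_h$. Theorem. Let $G$ be a group, let $\mathcal B=\bigoplus_{g\in G}\mathcal B_g$ be a $G$-graded algebra, put $\mathcal D_g=\mathcal B_g\mathcal B_{g^{-1}}$, and suppose that the ring $\mathcal D_g$ is $s$-unital for every $g\in G$. Then $\mathcal B$ is isomorphic,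 as a graded algebra, to the crossed product by some twisted partial action of $G$ on $\mathcal B_1$ if and only if the following two conditions hold: (i) $\mathcal B_g\mathcal B_{g^{-1}}\mathcal B_g=\mathcal B_g$ for all $g\in G$; (ii) for every $g\in G$ there exist an isomorphism $\psi_g:\mathcal D_g\to\mathcal B_g$ of left $\mathcal D_g$-modules and an isomorphism $\psi'_g:\mathcal D_{g^{-1}}\to\mathcal B_g$ of right $\mathcal D_{g^{-1}}$-modules such that $\psi_g(d)\,d'=d\,\psi'_g(d')$ for all $d\in\mathcal D_g$ and $d'\in\mathcal D_{g^{-1}}$. -/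

import Mathlib

/-! Algebras over a commutative unital ring `k` are associative and not necessarily unital. -/

section MulSpan

variable {k A : Type*} [CommRing k] [NonUnitalRing A] [Module k A]

/-- The product of two `k`-submodules of an algebra: the `k`-span of all the products
`a * b` with `a ∈ S` and `b ∈ T`. -/
def mulSpan (S T : Submodule k A) : Submodule k A :=
  Submodule.span k {x | ∃ a ∈ S, ∃ b ∈ T, a * b = x}

theorem mul_mem_mulSpan {S T : Submodule k A} {a b : A} (ha : a ∈ S) (hb : b ∈ T) :
    a * b ∈ mulSpan S T :=
  Submodule.subset_span ⟨a, ha, b, hb, rfl⟩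

theorem mulSpan_le {S T U : Submodule k A} :
    mulSpan S T ≤ U ↔ ∀ a ∈ S, ∀ b ∈ T, a * b ∈ U := by
  refine ⟨fun h a ha b hb => h (mul_mem_mulSpan ha hb), fun h => Submodule.span_le.2 ?_⟩
  rintro _ ⟨a, ha, b, hb, rfl⟩
  exact h a ha b hb

theorem mulSpan_mono {S S' T T' : Submodule k A} (hS : S ≤ S') (hT : T ≤ T') :
    mulSpan S T ≤ mulSpan S' T' :=
  mulSpan_le.2 fun _ ha _ hb => mul_mem_mulSpan (hS ha) (hT hb)

theorem mulSpan_assoc [IsScalarTower k A A] [SMulCommClass k A A] (S T U : Submodule k A) :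
    mulSpan (mulSpan S T) U = mulSpan S (mulSpan T U) := by
  apply le_antisymm
  · refine mulSpan_le.2 fun x hx c hc => ?_
    suffices h : mulSpan S T ≤
        (mulSpan S (mulSpan T U)).comap (LinearMap.mulRight k c) from h hx
    refine mulSpan_le.2 fun a ha b hb => ?_
    rw [Submodule.mem_comap, LinearMap.mulRight_apply, mul_assoc]
    exact mul_mem_mulSpan ha (mul_mem_mulSpan hb hc)
  · refine mulSpan_le.2 fun a ha x hx => ?_
    suffices h : mulSpan T U ≤
        (mulSpan (mulSpan S T) U).comap (LinearMap.mulLeft k a) from h hx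
    refine mulSpan_le.2 fun b hb c hc => ?_
    rw [Submodule.mem_comap, LinearMap.mulLeft_apply, ← mul_assoc]
    exact mul_mem_mulSpan (mul_mem_mulSpan ha hb) hc

end MulSpan

/-- A two-sided ideal of the `k`-algebra `A`. -/
structure AlgIdeal (k A : Type*) [CommRing k] [NonUnitalRing A] [Module k A]
    extends Submodule k A where
  mul_mem_left' : ∀ (a : A) {x : A}, x ∈ carrier → a * x ∈ carrier
  mul_mem_right' : ∀ {x : A} (a : A), x ∈ carrier → x * a ∈ carrier

namespace AlgIdeal

variable {k A : Type*} [CommRing k] [NonUnitalRing A] [Module k A]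

instance : SetLike (AlgIdeal k A) A where
  coe I := I.carrier
  coe_injective := by
    rintro ⟨I, _, _⟩ ⟨J, _, _⟩ h
    have : I = J := SetLike.coe_injective h
    subst this
    rfl

instance : NonUnitalSubringClass (AlgIdeal k A) A where
  add_mem {I} _ _ ha hb := I.toSubmodule.add_mem ha hb
  zero_mem I := I.toSubmodule.zero_mem
  neg_mem {I} _ ha := I.toSubmodule.neg_mem ha
  mul_mem {I} a _ _ hb := I.mul_mem_left' a hb

instance : SMulMemClass (AlgIdeal k A) k A where
  smul_mem {I} c _ ha := I.toSubmodule.smul_mem c ha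

theorem mul_mem_left (I : AlgIdeal k A) (a : A) {x : A} (hx : x ∈ I) : a * x ∈ I :=
  I.mul_mem_left' a hx

theorem mul_mem_right (I : AlgIdeal k A) {x : A} (a : A) (hx : x ∈ I) : x * a ∈ I :=
  I.mul_mem_right' a hx

theorem toSubmodule_inj {I J : AlgIdeal k A} (h : I.toSubmodule = J.toSubmodule) : I = J :=
  SetLike.coe_injective (congrArg (fun S : Submodule k A => (S : Set A)) h)

variable [IsScalarTower k A A] [SMulCommClass k A A]

/-- The product of two ideals. -/
instance : Mul (AlgIdeal k A) where
  mul I J :=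
    { mulSpan I.toSubmodule J.toSubmodule with
      mul_mem_left' := fun a x hx => by
        suffices h : mulSpan I.toSubmodule J.toSubmodule ≤
            (mulSpan I.toSubmodule J.toSubmodule).comap (LinearMap.mulLeft k a) from h hx
        refine mulSpan_le.2 fun b hb c hc => ?_
        rw [Submodule.mem_comap, LinearMap.mulLeft_apply, ← mul_assoc]
        exact mul_mem_mulSpan (I.mul_mem_left' a hb) hc
      mul_mem_right' := fun {x} a hx => by
        suffices h : mulSpan I.toSubmodule J.toSubmodule ≤
            (mulSpan I.toSubmodule J.toSubmodule).comap (LinearMap.mulRight k a) from h hx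
        refine mulSpan_le.2 fun b hb c hc => ?_
        rw [Submodule.mem_comap, LinearMap.mulRight_apply, mul_assoc]
        exact mul_mem_mulSpan hb (J.mul_mem_right' a hc) }

theorem toSubmodule_mul (I J : AlgIdeal k A) :
    (I * J).toSubmodule = mulSpan I.toSubmodule J.toSubmodule := rfl

instance : Semigroup (AlgIdeal k A) where
  mul_assoc _ _ _ := toSubmodule_inj (mulSpan_assoc _ _ _)

theorem mul_mem_mul {I J : AlgIdeal k A} {a b : A} (ha : a ∈ I) (hb : b ∈ J) : a * b ∈ I * J :=
  mul_mem_mulSpan (S := I.toSubmodule) (T := J.toSubmodule) ha hb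

theorem mem_left_of_mem_mul {I J : AlgIdeal k A} {x : A} (hx : x ∈ I * J) : x ∈ I :=
  (mulSpan_le (U := I.toSubmodule)).2 (fun _ ha b _ => I.mul_mem_right b ha) hx

theorem mem_right_of_mem_mul {I J : AlgIdeal k A} {x : A} (hx : x ∈ I * J) : x ∈ J :=
  (mulSpan_le (U := J.toSubmodule)).2 (fun a _ _ hb => J.mul_mem_left a hb) hx

end AlgIdeal

/-- A multiplier `w = (R, L)` of the algebra `A`, with `a w = R a` and `w a = L a`: `R` is an
endomorphism of the left module `A`, `L` is one of the right module `A`, and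
`(a w) b = a (w b)`. -/
@[ext]
structure Multiplier (k A : Type*) [CommRing k] [NonUnitalRing A] [Module k A] where
  R : A →ₗ[k] A
  L : A →ₗ[k] A
  R_mul : ∀ a b : A, R (a * b) = a * R b
  L_mul : ∀ a b : A, L (a * b) = L a * b
  balanced : ∀ a b : A, R a * b = a * L b

namespace Multiplier

variable {k A : Type*} [CommRing k] [NonUnitalRing A] [Module k A]

/-- Multiplication in the multiplier algebra: `a (w w') = (a w) w'` and `(w w') a = w (w' a)`. -/
instance : Monoid (Multiplier k A) where
  one := ⟨LinearMap.id, LinearMap.id, fun _ _ => rfl, fun _ _ => rfl, fun _ _ => rfl⟩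
  mul w w' :=
    { R := w'.R ∘ₗ w.R
      L := w.L ∘ₗ w'.L
      R_mul := fun a b => by simp [w.R_mul, w'.R_mul]
      L_mul := fun a b => by simp [w.L_mul, w'.L_mul]
      balanced := fun a b => by simp [w.balanced, w'.balanced] }
  mul_assoc _ _ _ := rfl
  one_mul _ := rfl
  mul_one _ := rfl

/-- A multiplier of an ideal `I` maps every idempotent ideal contained in `I` to itself. -/
theorem R_mem [IsScalarTower k A A] [SMulCommClass k A A] {I J : AlgIdeal k A}
    (w : Multiplier k I) (hJI : ∀ x ∈ J, x ∈ I) (hJ : J * J = J) {x : A} (hxI : x ∈ I)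
    (hx : x ∈ J) : (w.R ⟨x, hxI⟩ : A) ∈ J := by
  suffices h : ∀ y ∈ mulSpan J.toSubmodule J.toSubmodule,
      ∃ hy : y ∈ I, (w.R ⟨y, hy⟩ : A) ∈ J by
    rw [← hJ] at hx
    exact (h x hx).2
  intro y hy
  refine Submodule.span_induction ?_ ?_ ?_ ?_ hy
  · rintro _ ⟨a, ha, b, hb, rfl⟩
    refine ⟨I.mul_mem_left a (hJI b hb), ?_⟩
    have h : w.R ⟨a * b, I.mul_mem_left a (hJI b hb)⟩ = ⟨a, hJI a ha⟩ * w.R ⟨b, hJI b hb⟩ :=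
      w.R_mul ⟨a, hJI a ha⟩ ⟨b, hJI b hb⟩
    rw [h]
    exact J.mul_mem_right _ ha
  · refine ⟨zero_mem I, ?_⟩
    have h : w.R ⟨0, zero_mem I⟩ = 0 := map_zero w.R
    rw [h]
    exact zero_mem J
  · rintro a b _ _ ⟨ha, ha'⟩ ⟨hb, hb'⟩
    refine ⟨add_mem ha hb, ?_⟩
    have h : w.R ⟨a + b, add_mem ha hb⟩ = w.R ⟨a, ha⟩ + w.R ⟨b, hb⟩ :=
      map_add w.R ⟨a, ha⟩ ⟨b, hb⟩
    rw [h]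
    exact add_mem ha' hb'
  · rintro c a _ ⟨ha, ha'⟩
    refine ⟨SMulMemClass.smul_mem c ha, ?_⟩
    have h : w.R ⟨c • a, SMulMemClass.smul_mem c ha⟩ = c • w.R ⟨a, ha⟩ :=
      map_smul w.R c ⟨a, ha⟩
    rw [h]
    exact SMulMemClass.smul_mem c ha'

end Multiplier

/-- The part of a twisted partial action that does not involve the twisting: idempotent, pairwise
commuting ideals `D g` with `D 1 = A`, and algebra isomorphisms `θ g` from `D g⁻¹` onto `D g`,
with `θ 1` the identity and `θ g (D g⁻¹ * D h) = D g * D (g * h)`. -/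
structure PartialActionData (k G A : Type*) [CommRing k] [Group G] [NonUnitalRing A] [Module k A]
    [IsScalarTower k A A] [SMulCommClass k A A] where
  D : G → AlgIdeal k A
  θ : ∀ g : G, D g⁻¹ ≃ₗ[k] D g
  θ_mul : ∀ (g : G) (a b : D g⁻¹), θ g (a * b) = θ g a * θ g b
  D_idem : ∀ g : G, D g * D g = D g
  D_comm : ∀ g h : G, D g * D h = D h * D g
  D_one : ∀ a : A, a ∈ D 1
  θ_one : ∀ a : D (1 : G)⁻¹, (θ 1 a : A) = a
  θ_image : ∀ g h : G,
    (fun a : D g⁻¹ => (θ g a : A)) '' {a | (a : A) ∈ D g⁻¹ * D h} = (D g * D (g * h) : AlgIdeal k A)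

namespace PartialActionData

variable {k G A : Type*} [CommRing k] [Group G] [NonUnitalRing A] [Module k A]
  [IsScalarTower k A A] [SMulCommClass k A A] (P : PartialActionData k G A)

/-! The next facts say that the elements which occur in the axioms of a twisted partial action
lie in the domains of the maps that are applied to them. -/

theorem θ_mem {g h : G} {a : A} (ha : a ∈ P.D g⁻¹) (hah : a ∈ P.D g⁻¹ * P.D h) :
    (P.θ g ⟨a, ha⟩ : A) ∈ P.D g * P.D (g * h) := by
  have h1 : (P.θ g ⟨a, ha⟩ : A) ∈ ((P.D g * P.D (g * h) : AlgIdeal k A) : Set A) := by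
    rw [← P.θ_image g h]
    exact ⟨⟨a, ha⟩, hah, rfl⟩
  exact h1

theorem mem_inv_mul {g h : G} {a : A} (ha : a ∈ P.D h⁻¹ * P.D (h⁻¹ * g⁻¹)) :
    a ∈ P.D (g * h)⁻¹ := by
  rw [mul_inv_rev]
  exact AlgIdeal.mem_right_of_mem_mul ha

theorem θ_mem_inv {g h : G} {a : A} (ha : a ∈ P.D h⁻¹ * P.D (h⁻¹ * g⁻¹)) :
    (P.θ h ⟨a, AlgIdeal.mem_left_of_mem_mul ha⟩ : A) ∈ P.D g⁻¹ := by
  have h1 := AlgIdeal.mem_right_of_mem_mul (P.θ_mem (AlgIdeal.mem_left_of_mem_mul ha) ha)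
  rwa [mul_inv_cancel_left] at h1

theorem θ_mul_mem {g h : G} {a : A} (ha : a ∈ P.D h⁻¹ * P.D (h⁻¹ * g⁻¹)) :
    (P.θ (g * h) ⟨a, P.mem_inv_mul ha⟩ : A) ∈ P.D g * P.D (g * h) := by
  have h1 : a ∈ P.D (g * h)⁻¹ * P.D h⁻¹ := by
    rw [P.D_comm, mul_inv_rev]
    exact ha
  have h2 := P.θ_mem (P.mem_inv_mul ha) h1
  rwa [mul_inv_cancel_right, P.D_comm] at h2

theorem mem_mul_one {g h t : G} {a : A} (ha : a ∈ P.D g⁻¹ * P.D h * P.D t) :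
    a ∈ P.D g⁻¹ * P.D h := AlgIdeal.mem_left_of_mem_mul ha

theorem mem_mul_two {g h t : G} {a : A} (ha : a ∈ P.D g⁻¹ * P.D h * P.D t) :
    a ∈ P.D h * P.D t := by
  rw [mul_assoc] at ha
  exact AlgIdeal.mem_right_of_mem_mul ha

theorem mem_mul_three {g h t : G} {a : A} (ha : a ∈ P.D g⁻¹ * P.D h * P.D t) :
    a ∈ P.D g⁻¹ * P.D t := by
  rw [mul_assoc, P.D_comm h t, ← mul_assoc] at ha
  exact AlgIdeal.mem_left_of_mem_mul ha

theorem mem_inv {g h t : G} {a : A} (ha : a ∈ P.D g⁻¹ * P.D h * P.D t) :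
    a ∈ P.D g⁻¹ := AlgIdeal.mem_left_of_mem_mul (P.mem_mul_one ha)

theorem idem₃ (r s t : G) : P.D r * P.D s * P.D t * (P.D r * P.D s * P.D t) =
    P.D r * P.D s * P.D t := by
  have hc : ∀ g h : G, Commute (P.D g) (P.D h) := P.D_comm
  have h1 : IsIdempotentElem (P.D r * P.D s) :=
    IsIdempotentElem.mul_of_commute (hc r s) (P.D_idem r) (P.D_idem s)
  exact IsIdempotentElem.mul_of_commute ((hc r t).mul_left (hc s t)) h1 (P.D_idem t)

theorem R_mem_mul {g h t : G} (w : Multiplier k ↥(P.D h * P.D t)) {a : A}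
    (ha : a ∈ P.D g⁻¹ * P.D h * P.D t) :
    (w.R ⟨a, P.mem_mul_two ha⟩ : A) ∈ P.D g⁻¹ * P.D h * P.D t :=
  w.R_mem (fun _ hx => P.mem_mul_two hx) (P.idem₃ _ _ _) _ ha

theorem θ_R_mem {g h t : G} (w : Multiplier k ↥(P.D h * P.D t)) {a : A}
    (ha : a ∈ P.D g⁻¹ * P.D h * P.D t) :
    (P.θ g ⟨w.R ⟨a, P.mem_mul_two ha⟩, P.mem_inv (P.R_mem_mul w ha)⟩ : A) ∈
      P.D g * P.D (g * t) :=
  P.θ_mem _ (P.mem_mul_three (P.R_mem_mul w ha))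

theorem θ_mem_mul {g h t : G} {a : A} (ha : a ∈ P.D g⁻¹ * P.D h * P.D t) :
    (P.θ g ⟨a, P.mem_inv ha⟩ : A) ∈ P.D g * P.D (g * h) :=
  P.θ_mem _ (P.mem_mul_one ha)

theorem θ_mem₃ {g h t : G} {a : A} (ha : a ∈ P.D g⁻¹ * P.D h * P.D t) :
    (P.θ g ⟨a, P.mem_inv ha⟩ : A) ∈ P.D g * P.D (g * h) * P.D (g * t) := by
  -- `a` is a sum of products of two elements of `D g⁻¹ * D h * D t`
  set J := P.D g⁻¹ * P.D h * P.D t with hJ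
  have hJJ : J * J = J := P.idem₃ _ _ _
  suffices h : ∀ y ∈ mulSpan J.toSubmodule J.toSubmodule,
      ∃ hy : y ∈ P.D g⁻¹, (P.θ g ⟨y, hy⟩ : A) ∈ P.D g * P.D (g * h) * P.D (g * t) by
    have ha' := ha
    rw [← hJJ] at ha'
    exact (h a ha').2
  intro y hy
  refine Submodule.span_induction ?_ ?_ ?_ ?_ hy
  · rintro _ ⟨b, hb, c, hc, rfl⟩
    refine ⟨AlgIdeal.mul_mem_left _ b (P.mem_inv hc), ?_⟩
    have h1 : P.θ g ⟨b * c, AlgIdeal.mul_mem_left _ b (P.mem_inv hc)⟩ =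
        P.θ g ⟨b, P.mem_inv hb⟩ * P.θ g ⟨c, P.mem_inv hc⟩ :=
      P.θ_mul g ⟨b, P.mem_inv hb⟩ ⟨c, P.mem_inv hc⟩
    rw [h1]
    exact AlgIdeal.mul_mem_mul (P.θ_mem_mul hb)
      (AlgIdeal.mem_right_of_mem_mul (P.θ_mem (P.mem_inv hc) (P.mem_mul_three hc)))
  · refine ⟨zero_mem _, ?_⟩
    have h1 : P.θ g ⟨0, zero_mem _⟩ = 0 := map_zero (P.θ g)
    rw [h1]
    exact zero_mem _
  · rintro b c _ _ ⟨hb, hb'⟩ ⟨hc, hc'⟩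
    refine ⟨add_mem hb hc, ?_⟩
    have h1 : P.θ g ⟨b + c, add_mem hb hc⟩ = P.θ g ⟨b, hb⟩ + P.θ g ⟨c, hc⟩ :=
      map_add (P.θ g) ⟨b, hb⟩ ⟨c, hc⟩
    rw [h1]
    exact add_mem hb' hc'
  · rintro r b _ ⟨hb, hb'⟩
    refine ⟨SMulMemClass.smul_mem r hb, ?_⟩
    have h1 : P.θ g ⟨r • b, SMulMemClass.smul_mem r hb⟩ = r • P.θ g ⟨b, hb⟩ :=
      map_smul (P.θ g) r ⟨b, hb⟩
    rw [h1]
    exact SMulMemClass.smul_mem r hb'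

theorem R_θ_mem {g h t : G} (w : Multiplier k ↥(P.D g * P.D (g * h))) {a : A}
    (ha : a ∈ P.D g⁻¹ * P.D h * P.D (h * t)) :
    (w.R ⟨P.θ g ⟨a, P.mem_inv ha⟩, P.θ_mem_mul ha⟩ : A) ∈ P.D (g * h) * P.D (g * h * t) := by
  have h1 := w.R_mem (J := P.D g * P.D (g * h) * P.D (g * (h * t)))
    (fun _ hx => AlgIdeal.mem_left_of_mem_mul hx) (P.idem₃ _ _ _) (P.θ_mem_mul ha) (P.θ_mem₃ ha)
  rw [mul_assoc, ← mul_assoc g h t] at h1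
  exact AlgIdeal.mem_right_of_mem_mul h1

end PartialActionData

/-- A twisted partial action of the group `G` on the algebra `A`: partial action data together with
invertible multipliers `w g h` of `D g * D (g * h)` such that
`θ g (θ h a) = w g h (θ (g * h) a) (w g h)⁻¹` for `a ∈ D h⁻¹ * D (h⁻¹ * g⁻¹)`,
`w 1 g = w g 1 = 1`, and `θ g (a (w h t)) (w g (h * t)) = θ g a (w g h) (w (g * h) t)` for
`a ∈ D g⁻¹ * D h * D (h * t)`. -/
structure TwistedPartialAction (k G A : Type*) [CommRing k] [Group G] [NonUnitalRing A]
    [Module k A] [IsScalarTower k A A] [SMulCommClass k A A] extends PartialActionData k G A where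
  w : ∀ g h : G, (Multiplier k ↥(D g * D (g * h)))ˣ
  θ_θ : ∀ (g h : G) (a : A) (ha : a ∈ D h⁻¹ * D (h⁻¹ * g⁻¹)),
    (θ g ⟨θ h ⟨a, AlgIdeal.mem_left_of_mem_mul ha⟩, toPartialActionData.θ_mem_inv ha⟩ : A) =
      (w g h)⁻¹.val.R ((w g h).val.L
        ⟨θ (g * h) ⟨a, toPartialActionData.mem_inv_mul ha⟩, toPartialActionData.θ_mul_mem ha⟩)
  w_one_left : ∀ g : G, w 1 g = 1
  w_one_right : ∀ g : G, w g 1 = 1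
  cocycle : ∀ (g h t : G) (a : A) (ha : a ∈ D g⁻¹ * D h * D (h * t)),
    ((w g (h * t)).val.R
      ⟨θ g ⟨(w h t).val.R ⟨a, toPartialActionData.mem_mul_two ha⟩,
          toPartialActionData.mem_inv (toPartialActionData.R_mem_mul _ ha)⟩,
        toPartialActionData.θ_R_mem _ ha⟩ : A) =
      (w (g * h) t).val.R
        ⟨(w g h).val.R ⟨θ g ⟨a, toPartialActionData.mem_inv ha⟩,
            toPartialActionData.θ_mem_mul ha⟩,
          toPartialActionData.R_θ_mem _ ha⟩

namespace TwistedPartialAction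

variable {k G A : Type*} [CommRing k] [Group G] [NonUnitalRing A] [Module k A]
  [IsScalarTower k A A] [SMulCommClass k A A]

/-- The map `(a, b) ↦ θ g ((θ g)⁻¹ a * b)` from `D g × D h` to `D g * D (g * h)`. -/
def preMul (Θ : TwistedPartialAction k G A) (g h : G) (a : Θ.D g) (b : Θ.D h) :
    ↥(Θ.D g * Θ.D (g * h)) :=
  ⟨Θ.θ g ⟨((Θ.θ g).symm a : A) * b, AlgIdeal.mul_mem_right _ _ ((Θ.θ g).symm a).2⟩,
    Θ.θ_mem _ (AlgIdeal.mul_mem_mul ((Θ.θ g).symm a).2 b.2)⟩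

/-- The inclusion of `D g * D (g * h)` in `D (g * h)`. -/
def incl (Θ : TwistedPartialAction k G A) (g h : G) :
    ↥(Θ.D g * Θ.D (g * h)) →ₗ[k] Θ.D (g * h) where
  toFun x := ⟨x, AlgIdeal.mem_right_of_mem_mul x.2⟩
  map_add' _ _ := rfl
  map_smul' _ _ := rfl

/-- The product `(a δ_g) (b δ_h) = θ g ((θ g)⁻¹ a * b) w g h δ_{gh}` of homogeneous elements. -/
def homogMul (Θ : TwistedPartialAction k G A) (g h : G) :
    Θ.D g →ₗ[k] Θ.D h →ₗ[k] Θ.D (g * h) :=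
  LinearMap.mk₂ k (fun a b => Θ.incl g h ((Θ.w g h).val.R (Θ.preMul g h a b)))
    (fun a a' b => by
      rw [← map_add, ← map_add]
      congr 2
      apply Subtype.ext
      change (Θ.θ g _ : A) = Θ.θ g _ + Θ.θ g _
      rw [← AddMemClass.coe_add, ← map_add]
      congr 2
      apply Subtype.ext
      simp [add_mul])
    (fun c a b => by
      rw [← map_smul, ← map_smul]
      congr 2
      apply Subtype.ext
      change (Θ.θ g _ : A) = c • (Θ.θ g _ : A)
      rw [← SetLike.val_smul, ← map_smul]
      congr 2
      apply Subtype.ext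
      simp [smul_mul_assoc])
    (fun a b b' => by
      rw [← map_add, ← map_add]
      congr 2
      apply Subtype.ext
      change (Θ.θ g _ : A) = Θ.θ g _ + Θ.θ g _
      rw [← AddMemClass.coe_add, ← map_add]
      congr 2
      apply Subtype.ext
      simp [mul_add])
    (fun c a b => by
      rw [← map_smul, ← map_smul]
      congr 2
      apply Subtype.ext
      change (Θ.θ g _ : A) = c • (Θ.θ g _ : A)
      rw [← SetLike.val_smul, ← map_smul]
      congr 2
      apply Subtype.ext
      simp [mul_smul_comm])

/-- The crossed product of `A` and `G` by `Θ`: the direct sum of the `D g`, the element `a δ_g`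
being `DirectSum.lof k G _ g a`. -/
def CrossedProduct (Θ : TwistedPartialAction k G A) : Type _ :=
  DirectSum G fun g => Θ.D g

namespace CrossedProduct

variable (Θ : TwistedPartialAction k G A)

noncomputable instance : AddCommGroup Θ.CrossedProduct :=
  inferInstanceAs (AddCommGroup (DirectSum G fun g => Θ.D g))

noncomputable instance : Module k Θ.CrossedProduct :=
  inferInstanceAs (Module k (DirectSum G fun g => Θ.D g))

variable [DecidableEq G]

/-- The map `a ↦ a δ_g`. -/
noncomputable def single (g : G) : Θ.D g →ₗ[k] Θ.CrossedProduct :=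
  DirectSum.lof k G (fun g => Θ.D g) g

/-- The linear map on the crossed product with given restrictions to the `D g δ_g`. -/
noncomputable def lift {M : Type*} [AddCommGroup M] [Module k M]
    (f : ∀ g : G, Θ.D g →ₗ[k] M) : Θ.CrossedProduct →ₗ[k] M :=
  DirectSum.toModule k G M f

theorem lift_single {M : Type*} [AddCommGroup M] [Module k M]
    (f : ∀ g : G, Θ.D g →ₗ[k] M) (g : G) (a : Θ.D g) : lift Θ f (single Θ g a) = f g a :=
  DirectSum.toModule_lof (M := fun g => Θ.D g) (φ := f) k g a

/-- The multiplication of the crossed product, the bilinear extension of `homogMul`. -/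
noncomputable def mulHom : Θ.CrossedProduct →ₗ[k] Θ.CrossedProduct →ₗ[k] Θ.CrossedProduct :=
  lift Θ fun g => LinearMap.flip <|
    lift Θ fun h => ((Θ.homogMul g h).compr₂ (single Θ (g * h))).flip

noncomputable instance : NonUnitalNonAssocRing Θ.CrossedProduct where
  mul x y := mulHom Θ x y
  left_distrib x y z := map_add (mulHom Θ x) y z
  right_distrib x y z := LinearMap.map_add₂ (mulHom Θ) x y z
  zero_mul x := LinearMap.map_zero₂ (mulHom Θ) x
  mul_zero x := map_zero (mulHom Θ x)

theorem single_mul_single (g h : G) (a : Θ.D g) (b : Θ.D h) :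
    single Θ g a * single Θ h b = single Θ (g * h) (Θ.homogMul g h a b) := by
  change mulHom Θ (single Θ g a) (single Θ h b) = _
  rw [mulHom, lift_single, LinearMap.flip_apply, lift_single, LinearMap.flip_apply,
    LinearMap.compr₂_apply]

end CrossedProduct

end TwistedPartialAction

/-- A grading of the `k`-algebra `B` by the group `G`. -/
structure GroupGrading (k G B : Type*) [CommRing k] [Group G] [DecidableEq G] [NonUnitalRing B]
    [Module k B] where
  comp : G → Submodule k B
  isInternal : DirectSum.IsInternal comp
  mul_mem : ∀ {g h : G} {a b : B}, a ∈ comp g → b ∈ comp h → a * b ∈ comp (g * h)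

/-- A ring is left `s`-unital if every `r` is of the form `y * r`, right `s`-unital if every `r` is
of the form `r * y`, and `s`-unital if it is both. -/
def IsSUnital (R : Type*) [NonUnitalRing R] : Prop :=
  (∀ r : R, ∃ y : R, y * r = r) ∧ (∀ r : R, ∃ y : R, r * y = r)

namespace GroupGrading

variable {k G B : Type*} [CommRing k] [Group G] [DecidableEq G] [NonUnitalRing B]
  [Module k B] (𝓑 : GroupGrading k G B)

/-- The subalgebra `B_1` of `B`. -/
def one : NonUnitalSubalgebra k B :=
  { 𝓑.comp 1 with
    mul_mem' := fun {a b} ha hb => by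
      have h : a * b ∈ 𝓑.comp (1 * 1) := 𝓑.mul_mem ha hb
      rw [one_mul] at h
      exact h }

theorem mulSpan_inv_le_one (g : G) : mulSpan (𝓑.comp g) (𝓑.comp g⁻¹) ≤ 𝓑.comp 1 :=
  mulSpan_le.2 fun a ha b hb => by
    have h := 𝓑.mul_mem ha hb
    rwa [mul_inv_cancel] at h

variable [IsScalarTower k B B] [SMulCommClass k B B]

/-- The subalgebra `D_g = B_g B_{g⁻¹}` of `B` (an ideal of `B_1`). -/
def D (g : G) : NonUnitalSubalgebra k B :=
  { mulSpan (𝓑.comp g) (𝓑.comp g⁻¹) with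
    mul_mem' := fun {x y} hx hy => by
      suffices h : mulSpan (𝓑.comp g) (𝓑.comp g⁻¹) ≤
          (mulSpan (𝓑.comp g) (𝓑.comp g⁻¹)).comap (LinearMap.mulRight k y) from h hx
      refine mulSpan_le.2 fun a ha b hb => ?_
      rw [Submodule.mem_comap, LinearMap.mulRight_apply, mul_assoc]
      refine mul_mem_mulSpan ha ?_
      have h := 𝓑.mul_mem hb (𝓑.mulSpan_inv_le_one g hy)
      rwa [mul_one] at h }

/-- `B` is isomorphic, as a graded algebra, to the crossed product by some twisted partial action
of `G` on `B_1`. -/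
def IsCrossedProduct : Prop :=
  ∃ (Θ : TwistedPartialAction k G 𝓑.one) (φ : B ≃ₗ[k] Θ.CrossedProduct),
    (∀ x y : B, φ (x * y) = φ x * φ y) ∧
      ∀ g : G, (𝓑.comp g).map (φ : B →ₗ[k] Θ.CrossedProduct) =
        LinearMap.range (TwistedPartialAction.CrossedProduct.single Θ g)

end GroupGrading

/-!
An isomorphism `ψ_g` of left `D_g`-modules and an isomorphism `ψ'_g` of right `D_{g⁻¹}`-modules with
`ψ_g(d) d' = d ψ'_g(d')` amount to a formal homogeneous unit `u_g` of degree `g`, for which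
`ψ_g(d) = d u_g` and `ψ'_g(d') = u_g d'`. As the `D_g` are `s`-unital, `x ↦ x u_g` extends to a
partial bijection of `B` from `B D_g` onto `B D_{g⁻¹}`, and `x ↦ u_g x` to one from `D_{g⁻¹} B`
onto `D_g B`. Such pairs of partial bijections can be composed and inverted, and
`θ_g(a) = u_g a u_g⁻¹`, `w_{g,h} = u_g u_h u_{gh}⁻¹` define a twisted partial action whose crossed
product is `B`, via `a δ_g ↦ a u_g`. Every identity in `B_1` is checked after multiplying by the
unit that cancels the inverses, since right multiplication by `u_g` is injective on `B D_g`.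

Conversely, in a crossed product `a δ_1 ↦ a δ_g` is an isomorphism of left modules from
`D_g δ_1 = B_g B_{g⁻¹}` onto `B_g`, and `b δ_1 ↦ θ_g(b) δ_g` is one of right modules from
`D_{g⁻¹} δ_1`; they are balanced because `θ_g` is multiplicative.
-/

section SUnital

variable {k B : Type*} [CommRing k] [NonUnitalRing B] [Module k B]

theorem mul_mem_mulSpan_top_left [IsScalarTower k B B] [SMulCommClass k B B] {S : Submodule k B}
    (b : B) {x : B} (hx : x ∈ mulSpan ⊤ S) : b * x ∈ mulSpan ⊤ S := by
  have h : b * x ∈ mulSpan ⊤ (mulSpan ⊤ S) := mul_mem_mulSpan Submodule.mem_top hx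
  rw [← mulSpan_assoc] at h
  exact mulSpan_mono le_top le_rfl h

theorem mul_mem_mulSpan_top_right [IsScalarTower k B B] [SMulCommClass k B B] {S : Submodule k B}
    {x : B} (hx : x ∈ mulSpan S ⊤) (b : B) : x * b ∈ mulSpan S ⊤ := by
  have h : x * b ∈ mulSpan (mulSpan S ⊤) ⊤ := mul_mem_mulSpan hx Submodule.mem_top
  rw [mulSpan_assoc] at h
  exact mulSpan_mono le_rfl le_top h

namespace IsSUnital

theorem eq_of_forall_mul_right {A : Type*} [NonUnitalRing A] (hA : IsSUnital A) {x y : A}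
    (h : ∀ a, x * a = y * a) : x = y := by
  obtain ⟨e, he⟩ := hA.2 (x - y)
  rw [sub_mul, h, sub_self] at he
  exact sub_eq_zero.1 he.symm

theorem eq_of_forall_mul_left {A : Type*} [NonUnitalRing A] (hA : IsSUnital A) {x y : A}
    (h : ∀ a, a * x = a * y) : x = y := by
  obtain ⟨e, he⟩ := hA.1 (x - y)
  rw [mul_sub, h, sub_self] at he
  exact sub_eq_zero.1 he.symm

variable {D : NonUnitalSubalgebra k B}

theorem exists_common_right_unit (hD : IsSUnital D) {x y : B} {e f : D} (hx : x * e = x)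
    (hy : y * f = y) : ∃ u : D, x * u = x ∧ y * u = y := by
  obtain ⟨v, hv⟩ := hD.2 (f - f * e)
  have hfv : (f - f * e : B) * v = f - f * e := congrArg Subtype.val hv
  have hyv : (y - y * e) * v = y - y * e := by
    rw [← hy, mul_assoc y f e, ← mul_sub, mul_assoc, hfv]
  refine ⟨e + v - e * v, ?_, ?_⟩ <;> push_cast <;> rw [mul_sub, mul_add, ← mul_assoc]
  · rw [hx, add_sub_cancel_right]
  · rw [add_sub_assoc, ← sub_mul, hyv, add_sub_cancel]

theorem exists_common_left_unit (hD : IsSUnital D) {x y : B} {e f : D} (hx : e * x = x)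
    (hy : f * y = y) : ∃ u : D, u * x = x ∧ u * y = y := by
  obtain ⟨v, hv⟩ := hD.1 (f - e * f)
  have hfv : v * (f - e * f : B) = f - e * f := congrArg Subtype.val hv
  have hyv : v * (y - e * y) = y - e * y := by
    rw [← hy, ← mul_assoc (e : B) f y, ← sub_mul, ← mul_assoc, hfv]
  refine ⟨e + v - v * e, ?_, ?_⟩ <;> push_cast <;> rw [sub_mul, add_mul, mul_assoc]
  · rw [hx, add_sub_cancel_right]
  · rw [add_sub_assoc, ← mul_sub, hyv, add_sub_cancel]

theorem mem_mulSpan_top_left [IsScalarTower k B B] (hD : IsSUnital D) {x : B} :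
    x ∈ mulSpan ⊤ D.toSubmodule ↔ ∃ e : D, x * e = x := by
  refine ⟨fun hx => ?_, fun ⟨e, he⟩ => he ▸ mul_mem_mulSpan Submodule.mem_top e.2⟩
  refine Submodule.span_induction ?_ ⟨0, zero_mul _⟩ ?_ ?_ hx
  · rintro _ ⟨a, -, d, hd, rfl⟩
    obtain ⟨e, he⟩ := hD.2 ⟨d, hd⟩
    have hde : d * e = d := congrArg Subtype.val he
    exact ⟨e, by rw [mul_assoc, hde]⟩
  · rintro y z _ _ ⟨e, hy⟩ ⟨f, hz⟩
    obtain ⟨u, hyu, hzu⟩ := hD.exists_common_right_unit hy hz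
    exact ⟨u, by rw [add_mul, hyu, hzu]⟩
  · rintro c y _ ⟨e, hy⟩
    exact ⟨e, by rw [smul_mul_assoc, hy]⟩

theorem mem_mulSpan_top_right [SMulCommClass k B B] (hD : IsSUnital D) {x : B} :
    x ∈ mulSpan D.toSubmodule ⊤ ↔ ∃ e : D, e * x = x := by
  refine ⟨fun hx => ?_, fun ⟨e, he⟩ => he ▸ mul_mem_mulSpan e.2 Submodule.mem_top⟩
  refine Submodule.span_induction ?_ ⟨0, mul_zero _⟩ ?_ ?_ hx
  · rintro _ ⟨d, hd, a, -, rfl⟩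
    obtain ⟨e, he⟩ := hD.1 ⟨d, hd⟩
    have hde : e * d = d := congrArg Subtype.val he
    exact ⟨e, by rw [← mul_assoc, hde]⟩
  · rintro y z _ _ ⟨e, hy⟩ ⟨f, hz⟩
    obtain ⟨u, hyu, hzu⟩ := hD.exists_common_left_unit hy hz
    exact ⟨u, by rw [mul_add, hyu, hzu]⟩
  · rintro c y _ ⟨e, hy⟩
    exact ⟨e, by rw [mul_smul_comm, hy]⟩

theorem eq_of_mem_mulSpan_top_left [IsScalarTower k B B] (hD : IsSUnital D) {x y : B}
    (hx : x ∈ mulSpan ⊤ D.toSubmodule) (hy : y ∈ mulSpan ⊤ D.toSubmodule)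
    (h : ∀ d : D, x * d = y * d) : x = y := by
  obtain ⟨e, he⟩ := hD.mem_mulSpan_top_left.1 (sub_mem hx hy)
  rw [sub_mul, h, sub_self] at he
  exact sub_eq_zero.1 he.symm

theorem eq_of_mem_mulSpan_top_right [SMulCommClass k B B] (hD : IsSUnital D) {x y : B}
    (hx : x ∈ mulSpan D.toSubmodule ⊤) (hy : y ∈ mulSpan D.toSubmodule ⊤)
    (h : ∀ d : D, d * x = d * y) : x = y := by
  obtain ⟨e, he⟩ := hD.mem_mulSpan_top_right.1 (sub_mem hx hy)
  rw [mul_sub, h, sub_self] at he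
  exact sub_eq_zero.1 he.symm

theorem mem_mul_iff {A : Type*} [NonUnitalRing A] [Module k A] [IsScalarTower k A A]
    [SMulCommClass k A A] {I J : AlgIdeal k A} (hJ : IsSUnital J) {a : A} :
    a ∈ I * J ↔ a ∈ I ∧ a ∈ J := by
  refine ⟨fun ha => ⟨AlgIdeal.mem_left_of_mem_mul ha, AlgIdeal.mem_right_of_mem_mul ha⟩, ?_⟩
  rintro ⟨haI, haJ⟩
  obtain ⟨e, he⟩ := hJ.2 ⟨a, haJ⟩
  have hae : a * e = a := congrArg Subtype.val he
  exact hae ▸ AlgIdeal.mul_mem_mul haI e.2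

theorem algIdeal_mul {A : Type*} [NonUnitalRing A] [Module k A] [IsScalarTower k A A]
    [SMulCommClass k A A] {I J : AlgIdeal k A} (hI : IsSUnital I) (hJ : IsSUnital J) :
    IsSUnital ↥(I * J) := by
  refine ⟨fun a => ?_, fun a => ?_⟩
  · obtain ⟨e, he⟩ := hI.1 ⟨a, AlgIdeal.mem_left_of_mem_mul a.2⟩
    obtain ⟨f, hf⟩ := hJ.1 ⟨a, AlgIdeal.mem_right_of_mem_mul a.2⟩
    refine ⟨⟨e * f, AlgIdeal.mul_mem_mul e.2 f.2⟩, Subtype.ext ?_⟩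
    have he' : (e : A) * a = a := congrArg Subtype.val he
    have hf' : (f : A) * a = a := congrArg Subtype.val hf
    change (e : A) * f * a = a
    rw [mul_assoc, hf', he']
  · obtain ⟨e, he⟩ := hI.2 ⟨a, AlgIdeal.mem_left_of_mem_mul a.2⟩
    obtain ⟨f, hf⟩ := hJ.2 ⟨a, AlgIdeal.mem_right_of_mem_mul a.2⟩
    refine ⟨⟨e * f, AlgIdeal.mul_mem_mul e.2 f.2⟩, Subtype.ext ?_⟩
    have he' : (a : A) * e = a := congrArg Subtype.val he
    have hf' : (a : A) * f = a := congrArg Subtype.val hf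
    change (a : A) * (e * f) = a
    rw [← mul_assoc, he', hf']

end IsSUnital

end SUnital

namespace Multiplier

variable {k A : Type*} [CommRing k] [NonUnitalRing A] [Module k A]

theorem inv_R_eq_of_R_eq {w : (Multiplier k A)ˣ} {a b : A} (h : w.val.R a = b) :
    w⁻¹.val.R b = a :=
  h ▸ congrArg (fun v : Multiplier k A => v.R a) w.mul_inv

theorem R_surjective (w : (Multiplier k A)ˣ) : Function.Surjective w.val.R := fun a =>
  ⟨w⁻¹.val.R a, congrArg (fun v : Multiplier k A => v.R a) w.inv_mul⟩

theorem eq_one_of_R_eq (hA : IsSUnital A) {w : Multiplier k A} (h : ∀ a, w.R a = a) : w = 1 :=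
  Multiplier.ext (LinearMap.ext h) <| LinearMap.ext fun b => hA.eq_of_forall_mul_left fun a => by
    rw [← w.balanced, h]
    rfl

variable [IsScalarTower k A A] [SMulCommClass k A A]

/-- In an `s`-unital algebra the identity `(a w) b = a (w b)` alone makes the pair `(R, L)` of
maps a multiplier: it forces both maps to be linear. -/
def ofBalanced (hA : IsSUnital A) (R L : A → A) (h : ∀ a b, R a * b = a * L b) :
    Multiplier k A where
  R :=
    { toFun := R
      map_add' := fun a b => hA.eq_of_forall_mul_right fun c => by simp only [h, add_mul]
      map_smul' := fun r a => hA.eq_of_forall_mul_right fun c => by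
        simp only [h, smul_mul_assoc, RingHom.id_apply] }
  L :=
    { toFun := L
      map_add' := fun a b => hA.eq_of_forall_mul_left fun c => by simp only [← h, mul_add]
      map_smul' := fun r a => hA.eq_of_forall_mul_left fun c => by
        simp only [← h, mul_smul_comm, RingHom.id_apply] }
  R_mul a b := hA.eq_of_forall_mul_right fun c => by
    change R (a * b) * c = a * R b * c
    rw [h, mul_assoc, mul_assoc, h]
  L_mul a b := hA.eq_of_forall_mul_left fun c => by
    change c * L (a * b) = c * (L a * b)
    rw [← h, ← mul_assoc, ← mul_assoc, h]
  balanced := h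

/-- The invertible multiplier of an `s`-unital algebra given by a balanced pair of bijections. -/
def unitOfBalanced (hA : IsSUnital A) (R L : A ≃ A) (h : ∀ a b, R a * b = a * L b) :
    (Multiplier k A)ˣ where
  val := ofBalanced hA R L h
  inv := ofBalanced hA R.symm L.symm fun a b => by
    rw [← R.apply_symm_apply a, h, L.apply_symm_apply, R.symm_apply_apply]
  val_inv := Multiplier.ext (LinearMap.ext R.symm_apply_apply) (LinearMap.ext L.apply_symm_apply)
  inv_val := Multiplier.ext (LinearMap.ext R.apply_symm_apply) (LinearMap.ext L.symm_apply_apply)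

end Multiplier

/-- A formal invertible element `u` acting from both sides on parts of the ring `B`: `rho x`
stands for `x u` and `lam x` for `u x`, the two maps being defined on a left and on a right ideal,
respectively. -/
@[ext]
structure PartialMultiplier (B : Type*) [NonUnitalRing B] where
  rho : PartialEquiv B B
  lam : PartialEquiv B B
  mul_mem_rho_source : ∀ (b : B) {x : B}, x ∈ rho.source → b * x ∈ rho.source
  mul_mem_lam_source : ∀ {x : B} (b : B), x ∈ lam.source → x * b ∈ lam.source
  rho_mul : ∀ (b : B) {x : B}, x ∈ rho.source → rho (b * x) = b * rho x
  lam_mul : ∀ {x : B} (b : B), x ∈ lam.source → lam (x * b) = lam x * b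
  rho_mul_eq_mul_lam : ∀ {x y : B}, x ∈ rho.source → y ∈ lam.source → rho x * y = x * lam y

namespace PartialMultiplier

variable {B : Type*} [NonUnitalRing B]

instance : Mul (PartialMultiplier B) where
  mul U V :=
    { rho := U.rho.trans V.rho
      lam := V.lam.trans U.lam
      mul_mem_rho_source := fun b x hx => by
        rw [PartialEquiv.trans_source] at hx ⊢
        refine ⟨U.mul_mem_rho_source b hx.1, ?_⟩
        rw [Set.mem_preimage, U.rho_mul b hx.1]
        exact V.mul_mem_rho_source b hx.2
      mul_mem_lam_source := fun {x} b hx => by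
        rw [PartialEquiv.trans_source] at hx ⊢
        refine ⟨V.mul_mem_lam_source b hx.1, ?_⟩
        rw [Set.mem_preimage, V.lam_mul b hx.1]
        exact U.mul_mem_lam_source b hx.2
      rho_mul := fun b x hx => by
        rw [PartialEquiv.trans_source] at hx
        simp only [PartialEquiv.trans_apply, U.rho_mul b hx.1, V.rho_mul b hx.2]
      lam_mul := fun {x} b hx => by
        rw [PartialEquiv.trans_source] at hx
        simp only [PartialEquiv.trans_apply, V.lam_mul b hx.1, U.lam_mul b hx.2]
      rho_mul_eq_mul_lam := fun {x y} hx hy => by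
        rw [PartialEquiv.trans_source] at hx hy
        simp only [PartialEquiv.trans_apply]
        rw [V.rho_mul_eq_mul_lam hx.2 hy.1, U.rho_mul_eq_mul_lam hx.1 hy.2] }

instance : Inv (PartialMultiplier B) where
  inv U :=
    { rho := U.rho.symm
      lam := U.lam.symm
      mul_mem_rho_source := fun b x hx => by
        rw [← U.rho.right_inv hx, ← U.rho_mul b (U.rho.map_target hx)]
        exact U.rho.map_source (U.mul_mem_rho_source b (U.rho.map_target hx))
      mul_mem_lam_source := fun {x} b hx => by
        rw [← U.lam.right_inv hx, ← U.lam_mul b (U.lam.map_target hx)]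
        exact U.lam.map_source (U.mul_mem_lam_source b (U.lam.map_target hx))
      rho_mul := fun b x hx => by
        have hx' := U.rho.map_target hx
        rw [← U.rho.left_inv (U.mul_mem_rho_source b hx'), U.rho_mul b hx', U.rho.right_inv hx]
      lam_mul := fun {x} b hx => by
        have hx' := U.lam.map_target hx
        rw [← U.lam.left_inv (U.mul_mem_lam_source b hx'), U.lam_mul b hx', U.lam.right_inv hx]
      rho_mul_eq_mul_lam := fun {x y} hx hy => by
        conv_lhs => rw [← U.lam.right_inv hy]
        conv_rhs => rw [← U.rho.right_inv hx]
        exact (U.rho_mul_eq_mul_lam (U.rho.map_target hx) (U.lam.map_target hy)).symm }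

instance : InvolutiveInv (PartialMultiplier B) where
  inv_inv _ := rfl

instance : Semigroup (PartialMultiplier B) where
  mul_assoc _ _ _ := PartialMultiplier.ext (PartialEquiv.trans_assoc _ _ _)
    (PartialEquiv.trans_assoc _ _ _).symm

protected theorem mul_inv_rev (U V : PartialMultiplier B) : (U * V)⁻¹ = V⁻¹ * U⁻¹ :=
  PartialMultiplier.ext (PartialEquiv.trans_symm_eq_symm_trans_symm _ _)
    (PartialEquiv.trans_symm_eq_symm_trans_symm _ _)

theorem mul_rho_eq_iff (U : PartialMultiplier B) {x e : B} (hx : x ∈ U.rho.source) :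
    e * U.rho x = U.rho x ↔ e * x = x := by
  rw [← U.rho_mul e hx]
  exact U.rho.injOn.eq_iff (U.mul_mem_rho_source e hx) hx

theorem lam_mul_eq_iff (U : PartialMultiplier B) {x e : B} (hx : x ∈ U.lam.source) :
    U.lam x * e = U.lam x ↔ x * e = x := by
  rw [← U.lam_mul e hx]
  exact U.lam.injOn.eq_iff (U.mul_mem_lam_source e hx) hx

theorem rho_lam_comm (U V : PartialMultiplier B) {x e : B} (hx : x ∈ U.lam.source)
    (he : e ∈ V.rho.source) (hxe : x * e = x) : V.rho (U.lam x) = U.lam (V.rho x) := by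
  rw [← hxe, U.lam_mul e hx, V.rho_mul _ he, V.rho_mul _ he, U.lam_mul _ hx]

/-- `U` maps the set `S` into itself from both sides. -/
structure Preserves (U : PartialMultiplier B) (S : Set B) : Prop where
  subset_rho_source : S ⊆ U.rho.source
  subset_lam_source : S ⊆ U.lam.source
  rho_mapsTo : Set.MapsTo U.rho S S
  lam_mapsTo : Set.MapsTo U.lam S S

variable {A : Type*} {U : PartialMultiplier B} {ι : A → B}

theorem Preserves.exists_rho_equiv (h : U.Preserves (Set.range ι))
    (h' : U⁻¹.Preserves (Set.range ι)) (hι : Function.Injective ι) :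
    ∃ R : A ≃ A, ∀ a, ι (R a) = U.rho (ι a) := by
  choose R hR using fun a => h.rho_mapsTo (Set.mem_range_self a)
  choose R' hR' using fun a => h'.rho_mapsTo (Set.mem_range_self a)
  refine ⟨⟨R, R', fun a => hι ?_, fun a => hι ?_⟩, hR⟩
  · rw [hR', hR]
    exact U.rho.left_inv (h.subset_rho_source (Set.mem_range_self a))
  · rw [hR, hR']
    exact U.rho.right_inv (h'.subset_rho_source (Set.mem_range_self a))

theorem Preserves.exists_lam_equiv (h : U.Preserves (Set.range ι))
    (h' : U⁻¹.Preserves (Set.range ι)) (hι : Function.Injective ι) :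
    ∃ L : A ≃ A, ∀ a, ι (L a) = U.lam (ι a) := by
  choose L hL using fun a => h.lam_mapsTo (Set.mem_range_self a)
  choose L' hL' using fun a => h'.lam_mapsTo (Set.mem_range_self a)
  refine ⟨⟨L, L', fun a => hι ?_, fun a => hι ?_⟩, hL⟩
  · rw [hL', hL]
    exact U.lam.left_inv (h.subset_lam_source (Set.mem_range_self a))
  · rw [hL, hL']
    exact U.lam.right_inv (h'.subset_lam_source (Set.mem_range_self a))

theorem Preserves.exists_unit {k A : Type*} [CommRing k] [NonUnitalRing A] [Module k A]
    [IsScalarTower k A A] [SMulCommClass k A A] (hA : IsSUnital A) {ι : A →ₙ* B}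
    (hι : Function.Injective ι) (h : U.Preserves (Set.range ι))
    (h' : U⁻¹.Preserves (Set.range ι)) :
    ∃ w : (Multiplier k A)ˣ,
      (∀ a, ι (w.val.R a) = U.rho (ι a)) ∧ ∀ a, ι (w.val.L a) = U.lam (ι a) := by
  obtain ⟨R, hR⟩ := h.exists_rho_equiv h' hι
  obtain ⟨L, hL⟩ := h.exists_lam_equiv h' hι
  refine ⟨Multiplier.unitOfBalanced hA R L fun a b => hι ?_, hR, hL⟩
  rw [map_mul, map_mul, hR, hL]
  exact U.rho_mul_eq_mul_lam (h.subset_rho_source (Set.mem_range_self a))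
    (h.subset_lam_source (Set.mem_range_self b))

end PartialMultiplier

namespace GroupGrading

variable {k G B : Type*} [CommRing k] [Group G] [DecidableEq G] [NonUnitalRing B]
  [Module k B] {𝓑 : GroupGrading k G B}

theorem mul_mem_of_eq {g h l : G} {a b : B} (ha : a ∈ 𝓑.comp g) (hb : b ∈ 𝓑.comp h)
    (hl : g * h = l) : a * b ∈ 𝓑.comp l :=
  hl ▸ 𝓑.mul_mem ha hb

variable [IsScalarTower k B B]

theorem mem_comp_one_of_mem_D {g : G} {x : B} (hx : x ∈ 𝓑.D g) : x ∈ 𝓑.comp 1 :=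
  𝓑.mulSpan_inv_le_one g hx

theorem mul_mem_D_right {g : G} {a x : B} (hx : x ∈ 𝓑.D g) (ha : a ∈ 𝓑.comp 1) :
    x * a ∈ 𝓑.D g := by
  suffices h : mulSpan (𝓑.comp g) (𝓑.comp g⁻¹) ≤
      (mulSpan (𝓑.comp g) (𝓑.comp g⁻¹)).comap (LinearMap.mulRight k a) from h hx
  refine mulSpan_le.2 fun b hb c hc => ?_
  rw [Submodule.mem_comap, LinearMap.mulRight_apply, mul_assoc]
  exact mul_mem_mulSpan hb (mul_mem_of_eq hc ha (mul_one g⁻¹))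

/-- The left ideal `B D_g`. -/
def leftIdeal (𝓑 : GroupGrading k G B) (g : G) : Submodule k B := mulSpan ⊤ (𝓑.D g).toSubmodule

/-- The right ideal `D_g B`. -/
def rightIdeal (𝓑 : GroupGrading k G B) (g : G) : Submodule k B := mulSpan (𝓑.D g).toSubmodule ⊤

/-- The grading is nearly epsilon-strong: the rings `D_g` are `s`-unital and
`B_g B_{g⁻¹} B_g = B_g`. -/
structure NearlyEpsilonStrong (𝓑 : GroupGrading k G B) : Prop where
  sUnital : ∀ g : G, IsSUnital (𝓑.D g)
  symmetric : ∀ g : G, mulSpan (mulSpan (𝓑.comp g) (𝓑.comp g⁻¹)) (𝓑.comp g) = 𝓑.comp g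

theorem NearlyEpsilonStrong.comp_le_rightIdeal (H : 𝓑.NearlyEpsilonStrong) (g : G) :
    𝓑.comp g ≤ 𝓑.rightIdeal g :=
  (H.symmetric g).ge.trans (mulSpan_mono le_rfl le_top)

variable [SMulCommClass k B B]

theorem mul_mem_D_left {g : G} {a x : B} (ha : a ∈ 𝓑.comp 1) (hx : x ∈ 𝓑.D g) :
    a * x ∈ 𝓑.D g := by
  suffices h : mulSpan (𝓑.comp g) (𝓑.comp g⁻¹) ≤
      (mulSpan (𝓑.comp g) (𝓑.comp g⁻¹)).comap (LinearMap.mulLeft k a) from h hx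
  refine mulSpan_le.2 fun b hb c hc => ?_
  rw [Submodule.mem_comap, LinearMap.mulLeft_apply, ← mul_assoc]
  exact mul_mem_mulSpan (mul_mem_of_eq ha hb (one_mul g)) hc

/-- `D g`, as an ideal of `B_1`. -/
def ideal (𝓑 : GroupGrading k G B) (g : G) : AlgIdeal k 𝓑.one where
  carrier := {a | (a : B) ∈ 𝓑.D g}
  add_mem' := fun ha hb => (𝓑.D g).add_mem' ha hb
  zero_mem' := zero_mem (𝓑.D g)
  smul_mem' := fun c _ ha => (𝓑.D g).smul_mem' c ha
  mul_mem_left' := fun a _ hx => mul_mem_D_left a.2 hx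
  mul_mem_right' := fun a hx => mul_mem_D_right hx a.2

/-- The ideal `D g` of `B_1` is the subalgebra `D g` of `B`. -/
def idealEquiv (𝓑 : GroupGrading k G B) (g : G) : 𝓑.ideal g ≃ₗ[k] 𝓑.D g where
  toFun a := ⟨a, a.2⟩
  invFun d := ⟨⟨d, mem_comp_one_of_mem_D d.2⟩, d.2⟩
  map_add' _ _ := rfl
  map_smul' _ _ := rfl

namespace NearlyEpsilonStrong

variable (H : 𝓑.NearlyEpsilonStrong)

include H

theorem comp_le_leftIdeal (g : G) : 𝓑.comp g ≤ 𝓑.leftIdeal g⁻¹ := by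
  have h := H.symmetric g
  rw [mulSpan_assoc] at h
  refine h.ge.trans (mulSpan_mono le_top ?_)
  change _ ≤ mulSpan (𝓑.comp g⁻¹) (𝓑.comp g⁻¹⁻¹)
  rw [inv_inv]

theorem mem_leftIdeal_iff_mem_rightIdeal {g : G} (h : G) {b : B} (hb : b ∈ 𝓑.comp g) :
    b ∈ 𝓑.leftIdeal h ↔ b ∈ 𝓑.rightIdeal (g * h) := by
  constructor
  · intro hbh
    obtain ⟨e, he⟩ := (H.sUnital h).mem_mulSpan_top_left.1 hbh
    have hle : mulSpan (𝓑.comp h) (𝓑.comp h⁻¹) ≤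
        (𝓑.rightIdeal (g * h)).comap (LinearMap.mulLeft k b) := by
      refine mulSpan_le.2 fun x hx y _ => ?_
      rw [Submodule.mem_comap, LinearMap.mulLeft_apply, ← mul_assoc]
      exact mul_mem_mulSpan_top_right (H.comp_le_rightIdeal _ (𝓑.mul_mem hb hx)) y
    exact he ▸ hle e.2
  · intro hbh
    obtain ⟨e, he⟩ := (H.sUnital (g * h)).mem_mulSpan_top_right.1 hbh
    have hle : mulSpan (𝓑.comp (g * h)) (𝓑.comp (g * h)⁻¹) ≤
        (𝓑.leftIdeal h).comap (LinearMap.mulRight k b) := by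
      refine mulSpan_le.2 fun x _ y hy => ?_
      rw [Submodule.mem_comap, LinearMap.mulRight_apply, mul_assoc]
      have hyb : y * b ∈ 𝓑.comp h⁻¹ := mul_mem_of_eq hy hb (by group)
      exact mul_mem_mulSpan_top_left x (inv_inv h ▸ H.comp_le_leftIdeal h⁻¹ hyb)
    exact he ▸ hle e.2

theorem mem_D_iff_mem_rightIdeal (g : G) {x : B} (hx : x ∈ 𝓑.comp 1) :
    x ∈ 𝓑.D g ↔ x ∈ 𝓑.rightIdeal g := by
  rw [rightIdeal, (H.sUnital g).mem_mulSpan_top_right]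
  refine ⟨fun h => ?_, fun ⟨e, he⟩ => he ▸ mul_mem_D_right e.2 hx⟩
  obtain ⟨e, he⟩ := (H.sUnital g).1 ⟨x, h⟩
  exact ⟨e, congrArg Subtype.val he⟩

theorem mem_D_iff_mem_leftIdeal (g : G) {x : B} (hx : x ∈ 𝓑.comp 1) :
    x ∈ 𝓑.D g ↔ x ∈ 𝓑.leftIdeal g := by
  rw [H.mem_leftIdeal_iff_mem_rightIdeal g hx, one_mul, H.mem_D_iff_mem_rightIdeal g hx]

theorem D_le_rightIdeal (g : G) {x : B} (hx : x ∈ 𝓑.D g) : x ∈ 𝓑.rightIdeal g :=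
  (H.mem_D_iff_mem_rightIdeal g (mem_comp_one_of_mem_D hx)).1 hx

theorem D_le_leftIdeal (g : G) {x : B} (hx : x ∈ 𝓑.D g) : x ∈ 𝓑.leftIdeal g :=
  (H.mem_D_iff_mem_leftIdeal g (mem_comp_one_of_mem_D hx)).1 hx

theorem D_one : (𝓑.D 1).toSubmodule = 𝓑.comp 1 := by
  refine le_antisymm (fun x => mem_comp_one_of_mem_D) fun x hx => ?_
  exact (H.mem_D_iff_mem_rightIdeal 1 hx).2 (H.comp_le_rightIdeal 1 hx)

theorem isSUnital_ideal (g : G) : IsSUnital (𝓑.ideal g) := by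
  refine ⟨fun a => ?_, fun a => ?_⟩
  · obtain ⟨e, he⟩ := (H.sUnital g).1 (𝓑.idealEquiv g a)
    exact ⟨(𝓑.idealEquiv g).symm e, (𝓑.idealEquiv g).injective he⟩
  · obtain ⟨e, he⟩ := (H.sUnital g).2 (𝓑.idealEquiv g a)
    exact ⟨(𝓑.idealEquiv g).symm e, (𝓑.idealEquiv g).injective he⟩

theorem mem_ideal_mul_iff {g h : G} {a : 𝓑.one} :
    a ∈ 𝓑.ideal g * 𝓑.ideal h ↔ (a : B) ∈ 𝓑.D g ∧ (a : B) ∈ 𝓑.D h :=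
  (H.isSUnital_ideal h).mem_mul_iff

end NearlyEpsilonStrong

end GroupGrading

theorem exists_partialEquiv_of_existsUnique {α β : Type*} [Nonempty α] [Nonempty β] {s : Set α}
    {t : Set β} {P : α → β → Prop} (hst : ∀ x ∈ s, ∃! y, y ∈ t ∧ P x y)
    (hts : ∀ y ∈ t, ∃! x, x ∈ s ∧ P x y) :
    ∃ e : PartialEquiv α β, e.source = s ∧ e.target = t ∧
      ∀ x ∈ s, ∀ y ∈ t, e x = y ↔ P x y := by
  choose! f hf hf' using hst
  choose! f' hf₂ hf₂' using hts
  refine ⟨⟨f, f', s, t, fun x hx => (hf x hx).1, fun y hy => (hf₂ y hy).1, fun x hx => ?_,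
    fun y hy => ?_⟩, rfl, rfl, fun x hx y hy => ⟨?_, fun h => (hf' x hx y ⟨hy, h⟩).symm⟩⟩
  · exact (hf₂' _ (hf x hx).1 x ⟨hx, (hf x hx).2⟩).symm
  · exact (hf' _ (hf₂ y hy).1 y ⟨hy, (hf₂ y hy).2⟩).symm
  · rintro rfl
    exact (hf x hx).2

namespace GroupGrading

variable {k G B : Type*} [CommRing k] [Group G] [DecidableEq G] [NonUnitalRing B]
  [Module k B] [IsScalarTower k B B] {𝓑 : GroupGrading k G B}

/-- Formal invertible elements `u_g` of degree `g`, multiplying `D_g` from the right and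
`D_{g⁻¹}` from the left: `ψ g d` stands for `d u_g` and `ψ' g d` for `u_g d`, and `u_1 = 1`. -/
structure LocalUnits (𝓑 : GroupGrading k G B) extends NearlyEpsilonStrong 𝓑 where
  ψ : ∀ g : G, 𝓑.D g ≃ₗ[k] 𝓑.comp g
  ψ' : ∀ g : G, 𝓑.D g⁻¹ ≃ₗ[k] 𝓑.comp g
  balanced : ∀ (g : G) (d : 𝓑.D g) (d' : 𝓑.D g⁻¹), (ψ g d : B) * d' = d * ψ' g d'
  ψ_one : ∀ d : 𝓑.D 1, (ψ 1 d : B) = d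
  ψ'_one : ∀ d : 𝓑.D (1 : G)⁻¹, (ψ' 1 d : B) = d

theorem LocalUnits.exists_mul_eq_mul_ψ' (T : 𝓑.LocalUnits) {g : G} {e : B} (he : e ∈ 𝓑.D g⁻¹) :
    ∃ s ∈ 𝓑.comp g⁻¹, ∀ d' : 𝓑.D g⁻¹, e * d' = s * T.ψ' g d' := by
  refine Submodule.span_induction ?_ ⟨0, zero_mem _, fun _ => by rw [zero_mul, zero_mul]⟩ ?_ ?_ he
  · rintro _ ⟨b, hb, c, hc, rfl⟩
    rw [inv_inv] at hc
    obtain ⟨d, hd⟩ := (T.ψ g).surjective ⟨c, hc⟩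
    have hdc : (T.ψ g d : B) = c := congrArg Subtype.val hd
    refine ⟨b * d, mul_mem_of_eq hb (mem_comp_one_of_mem_D d.2) (mul_one _), fun d' => ?_⟩
    rw [← hdc, mul_assoc, mul_assoc, T.balanced]
  · rintro x y _ _ ⟨s, hs, hx⟩ ⟨t, ht, hy⟩
    exact ⟨s + t, add_mem hs ht, fun d' => by rw [add_mul, add_mul, hx, hy]⟩
  · rintro c x _ ⟨s, hs, hx⟩
    exact ⟨c • s, Submodule.smul_mem _ c hs, fun d' => by rw [smul_mul_assoc, smul_mul_assoc, hx]⟩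

variable [SMulCommClass k B B]

namespace LocalUnits

variable (T : 𝓑.LocalUnits)

theorem exists_mul_eq_ψ_mul {g : G} {e : B} (he : e ∈ 𝓑.D g) :
    ∃ s ∈ 𝓑.comp g⁻¹, ∀ d : 𝓑.D g, d * e = T.ψ g d * s := by
  refine Submodule.span_induction ?_ ⟨0, zero_mem _, fun _ => by rw [mul_zero, mul_zero]⟩ ?_ ?_ he
  · rintro _ ⟨c, hc, b, hb, rfl⟩
    obtain ⟨d', hd'⟩ := (T.ψ' g).surjective ⟨c, hc⟩
    have hdc : (T.ψ' g d' : B) = c := congrArg Subtype.val hd'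
    refine ⟨d' * b, mul_mem_of_eq (mem_comp_one_of_mem_D d'.2) hb (one_mul _), fun d => ?_⟩
    rw [← hdc, ← mul_assoc, ← mul_assoc, T.balanced]
  · rintro x y _ _ ⟨s, hs, hx⟩ ⟨t, ht, hy⟩
    exact ⟨s + t, add_mem hs ht, fun d' => by rw [mul_add, mul_add, hx, hy]⟩
  · rintro c x _ ⟨s, hs, hx⟩
    exact ⟨c • s, Submodule.smul_mem _ c hs, fun d' => by rw [mul_smul_comm, mul_smul_comm, hx]⟩

theorem eq_of_forall_mul_ψ' {g : G} {x y : B} (hx : x ∈ 𝓑.leftIdeal g) (hy : y ∈ 𝓑.leftIdeal g)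
    (h : ∀ d' : 𝓑.D g⁻¹, x * T.ψ' g d' = y * T.ψ' g d') : x = y := by
  have hle : mulSpan (𝓑.comp g) (𝓑.comp g⁻¹) ≤
      LinearMap.eqLocus (LinearMap.mulLeft k x) (LinearMap.mulLeft k y) := by
    refine mulSpan_le.2 fun c hc b _ => ?_
    obtain ⟨d', hd'⟩ := (T.ψ' g).surjective ⟨c, hc⟩
    have hdc : (T.ψ' g d' : B) = c := congrArg Subtype.val hd'
    rw [LinearMap.mem_eqLocus, LinearMap.mulLeft_apply, LinearMap.mulLeft_apply, ← mul_assoc,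
      ← mul_assoc, ← hdc, h]
  exact (T.sUnital g).eq_of_mem_mulSpan_top_left hx hy fun d => hle d.2

theorem eq_of_forall_ψ_mul {g : G} {x y : B} (hx : x ∈ 𝓑.rightIdeal g⁻¹)
    (hy : y ∈ 𝓑.rightIdeal g⁻¹) (h : ∀ d : 𝓑.D g, T.ψ g d * x = T.ψ g d * y) : x = y := by
  have hle : mulSpan (𝓑.comp g⁻¹) (𝓑.comp g⁻¹⁻¹) ≤
      LinearMap.eqLocus (LinearMap.mulRight k x) (LinearMap.mulRight k y) := by
    refine mulSpan_le.2 fun b _ c hc => ?_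
    rw [inv_inv] at hc
    obtain ⟨d, hd⟩ := (T.ψ g).surjective ⟨c, hc⟩
    have hdc : (T.ψ g d : B) = c := congrArg Subtype.val hd
    rw [LinearMap.mem_eqLocus, LinearMap.mulRight_apply, LinearMap.mulRight_apply, mul_assoc,
      mul_assoc, ← hdc, h]
  exact (T.sUnital g⁻¹).eq_of_mem_mulSpan_top_right hx hy fun d => hle d.2

theorem exists_rho (g : G) :
    ∃ e : PartialEquiv B B, e.source = 𝓑.leftIdeal g ∧ e.target = 𝓑.leftIdeal g⁻¹ ∧
      ∀ x ∈ (𝓑.leftIdeal g : Set B), ∀ y ∈ (𝓑.leftIdeal g⁻¹ : Set B),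
        e x = y ↔ ∀ d' : 𝓑.D g⁻¹, y * d' = x * T.ψ' g d' := by
  refine exists_partialEquiv_of_existsUnique (fun x hx => ?_) fun y hy => ?_
  · obtain ⟨e, he⟩ := (T.sUnital g).mem_mulSpan_top_left.1 hx
    refine ⟨x * T.ψ g e, ⟨?_, fun d' => ?_⟩, fun y ⟨hy, h⟩ => ?_⟩
    · exact mul_mem_mulSpan_top_left x (T.comp_le_leftIdeal g (T.ψ g e).2)
    · rw [mul_assoc, T.balanced, ← mul_assoc, he]
    · refine (T.sUnital g⁻¹).eq_of_mem_mulSpan_top_left hy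
        (mul_mem_mulSpan_top_left x (T.comp_le_leftIdeal g (T.ψ g e).2)) fun d' => ?_
      rw [h, mul_assoc, T.balanced, ← mul_assoc, he]
  · obtain ⟨e, he⟩ := (T.sUnital g⁻¹).mem_mulSpan_top_left.1 hy
    obtain ⟨s, hs, hes⟩ := T.exists_mul_eq_mul_ψ' e.2
    have hmem : y * s ∈ 𝓑.leftIdeal g :=
      mul_mem_mulSpan_top_left y (inv_inv g ▸ T.comp_le_leftIdeal g⁻¹ hs)
    have hys : ∀ d' : 𝓑.D g⁻¹, y * d' = y * s * T.ψ' g d' := fun d' => by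
      rw [mul_assoc, ← hes, ← mul_assoc, he]
    exact ⟨y * s, ⟨hmem, hys⟩, fun x ⟨hx, h⟩ =>
      T.eq_of_forall_mul_ψ' hx hmem fun d' => (h d').symm.trans (hys d')⟩

theorem exists_lam (g : G) :
    ∃ e : PartialEquiv B B, e.source = 𝓑.rightIdeal g⁻¹ ∧ e.target = 𝓑.rightIdeal g ∧
      ∀ x ∈ (𝓑.rightIdeal g⁻¹ : Set B), ∀ y ∈ (𝓑.rightIdeal g : Set B),
        e x = y ↔ ∀ d : 𝓑.D g, (d : B) * y = T.ψ g d * x := by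
  refine exists_partialEquiv_of_existsUnique (fun x hx => ?_) fun y hy => ?_
  · obtain ⟨e, he⟩ := (T.sUnital g⁻¹).mem_mulSpan_top_right.1 hx
    have hmem : T.ψ' g e * x ∈ 𝓑.rightIdeal g :=
      mul_mem_mulSpan_top_right (T.comp_le_rightIdeal g (T.ψ' g e).2) x
    have hxe : ∀ d : 𝓑.D g, (d : B) * (T.ψ' g e * x) = T.ψ g d * x := fun d => by
      rw [← mul_assoc, ← T.balanced, mul_assoc, he]
    exact ⟨T.ψ' g e * x, ⟨hmem, hxe⟩, fun y ⟨hy, h⟩ =>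
      (T.sUnital g).eq_of_mem_mulSpan_top_right hy hmem fun d => (h d).trans (hxe d).symm⟩
  · obtain ⟨e, he⟩ := (T.sUnital g).mem_mulSpan_top_right.1 hy
    obtain ⟨s, hs, hes⟩ := T.exists_mul_eq_ψ_mul e.2
    have hmem : s * y ∈ 𝓑.rightIdeal g⁻¹ :=
      mul_mem_mulSpan_top_right (T.comp_le_rightIdeal g⁻¹ hs) y
    have hys : ∀ d : 𝓑.D g, (d : B) * y = T.ψ g d * (s * y) := fun d => by
      rw [← mul_assoc, ← hes, mul_assoc, he]
    exact ⟨s * y, ⟨hmem, hys⟩, fun x ⟨hx, h⟩ =>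
      T.eq_of_forall_ψ_mul hx hmem fun d => (h d).symm.trans (hys d)⟩

/-- Right multiplication by `u_g`, from `B D_g` onto `B D_{g⁻¹}`. -/
noncomputable def rho (g : G) : PartialEquiv B B := (T.exists_rho g).choose

/-- Left multiplication by `u_g`, from `D_{g⁻¹} B` onto `D_g B`. -/
noncomputable def lam (g : G) : PartialEquiv B B := (T.exists_lam g).choose

theorem rho_source (g : G) : (T.rho g).source = 𝓑.leftIdeal g := (T.exists_rho g).choose_spec.1

theorem rho_target (g : G) : (T.rho g).target = 𝓑.leftIdeal g⁻¹ :=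
  (T.exists_rho g).choose_spec.2.1

theorem lam_source (g : G) : (T.lam g).source = 𝓑.rightIdeal g⁻¹ :=
  (T.exists_lam g).choose_spec.1

theorem lam_target (g : G) : (T.lam g).target = 𝓑.rightIdeal g :=
  (T.exists_lam g).choose_spec.2.1

theorem rho_eq_iff {g : G} {x y : B} (hx : x ∈ 𝓑.leftIdeal g) (hy : y ∈ 𝓑.leftIdeal g⁻¹) :
    T.rho g x = y ↔ ∀ d' : 𝓑.D g⁻¹, y * d' = x * T.ψ' g d' :=
  (T.exists_rho g).choose_spec.2.2 x hx y hy

theorem lam_eq_iff {g : G} {x y : B} (hx : x ∈ 𝓑.rightIdeal g⁻¹) (hy : y ∈ 𝓑.rightIdeal g) :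
    T.lam g x = y ↔ ∀ d : 𝓑.D g, (d : B) * y = T.ψ g d * x :=
  (T.exists_lam g).choose_spec.2.2 x hx y hy

theorem rho_mem {g : G} {x : B} (hx : x ∈ 𝓑.leftIdeal g) : T.rho g x ∈ 𝓑.leftIdeal g⁻¹ := by
  rw [← SetLike.mem_coe, ← T.rho_target]
  exact (T.rho g).map_source (T.rho_source g ▸ hx)

theorem lam_mem {g : G} {x : B} (hx : x ∈ 𝓑.rightIdeal g⁻¹) : T.lam g x ∈ 𝓑.rightIdeal g := by
  rw [← SetLike.mem_coe, ← T.lam_target]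
  exact (T.lam g).map_source (T.lam_source g ▸ hx)

theorem rho_mul_D {g : G} {x : B} (hx : x ∈ 𝓑.leftIdeal g) (d' : 𝓑.D g⁻¹) :
    T.rho g x * d' = x * T.ψ' g d' :=
  (T.rho_eq_iff hx (T.rho_mem hx)).1 rfl d'

theorem D_mul_lam {g : G} {x : B} (hx : x ∈ 𝓑.rightIdeal g⁻¹) (d : 𝓑.D g) :
    d * T.lam g x = T.ψ g d * x :=
  (T.lam_eq_iff hx (T.lam_mem hx)).1 rfl d

theorem rho_coe {g : G} (d : 𝓑.D g) : T.rho g d = T.ψ g d :=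
  (T.rho_eq_iff (T.D_le_leftIdeal g d.2) (T.comp_le_leftIdeal g (T.ψ g d).2)).2 (T.balanced g d)

theorem lam_coe {g : G} (d' : 𝓑.D g⁻¹) : T.lam g d' = T.ψ' g d' :=
  (T.lam_eq_iff (T.D_le_rightIdeal g⁻¹ d'.2) (T.comp_le_rightIdeal g (T.ψ' g d').2)).2
    fun d => (T.balanced g d d').symm

theorem rho_one {x : B} (hx : x ∈ 𝓑.leftIdeal 1) : T.rho 1 x = x :=
  (T.rho_eq_iff hx ((inv_one (G := G)).symm ▸ hx)).2 fun d' => by rw [T.ψ'_one]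

theorem lam_one {x : B} (hx : x ∈ 𝓑.rightIdeal 1) : T.lam 1 x = x :=
  (T.lam_eq_iff ((inv_one (G := G)).symm ▸ hx) hx).2 fun d => by rw [T.ψ_one]

theorem rho_mul {g : G} (b : B) {x : B} (hx : x ∈ 𝓑.leftIdeal g) :
    T.rho g (b * x) = b * T.rho g x :=
  (T.rho_eq_iff (mul_mem_mulSpan_top_left b hx) (mul_mem_mulSpan_top_left b (T.rho_mem hx))).2
    fun d' => by rw [mul_assoc, mul_assoc, T.rho_mul_D hx]

theorem lam_mul {g : G} {x : B} (b : B) (hx : x ∈ 𝓑.rightIdeal g⁻¹) :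
    T.lam g (x * b) = T.lam g x * b :=
  (T.lam_eq_iff (mul_mem_mulSpan_top_right hx b) (mul_mem_mulSpan_top_right (T.lam_mem hx) b)).2
    fun d => by rw [← mul_assoc, ← mul_assoc, T.D_mul_lam hx]

theorem rho_mul_eq_mul_lam {g : G} {x y : B} (hx : x ∈ 𝓑.leftIdeal g)
    (hy : y ∈ 𝓑.rightIdeal g⁻¹) : T.rho g x * y = x * T.lam g y := by
  obtain ⟨e, he⟩ := (T.sUnital g).mem_mulSpan_top_left.1 hx
  obtain ⟨f, hf⟩ := (T.sUnital g⁻¹).mem_mulSpan_top_right.1 hy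
  calc T.rho g x * y = x * T.ψ' g f * y := by rw [← T.rho_mul_D hx, mul_assoc, hf]
    _ = x * (T.ψ g e * f) * y := by rw [T.balanced, ← mul_assoc x, he]
    _ = x * (e * T.lam g y) := by rw [T.D_mul_lam hy, mul_assoc, mul_assoc, hf]
    _ = x * T.lam g y := by rw [← mul_assoc, he]

theorem mem_rho_source {g : G} {x : B} : x ∈ (T.rho g).source ↔ x ∈ 𝓑.leftIdeal g := by
  rw [T.rho_source, SetLike.mem_coe]

theorem mem_lam_source {g : G} {x : B} : x ∈ (T.lam g).source ↔ x ∈ 𝓑.rightIdeal g⁻¹ := by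
  rw [T.lam_source, SetLike.mem_coe]

/-- The formal unit `u_g` as a partial multiplier of `B`. -/
noncomputable def u (g : G) : PartialMultiplier B where
  rho := T.rho g
  lam := T.lam g
  mul_mem_rho_source b _ hx :=
    T.mem_rho_source.2 (mul_mem_mulSpan_top_left b (T.mem_rho_source.1 hx))
  mul_mem_lam_source b hx :=
    T.mem_lam_source.2 (mul_mem_mulSpan_top_right (T.mem_lam_source.1 hx) b)
  rho_mul b _ hx := T.rho_mul b (T.mem_rho_source.1 hx)
  lam_mul b hx := T.lam_mul b (T.mem_lam_source.1 hx)
  rho_mul_eq_mul_lam hx hy :=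
    T.rho_mul_eq_mul_lam (T.mem_rho_source.1 hx) (T.mem_lam_source.1 hy)

end LocalUnits

end GroupGrading

namespace PartialMultiplier

theorem rho_mem_mulSpan_iff {k B : Type*} [CommRing k] [NonUnitalRing B] [Module k B]
    [SMulCommClass k B B] {D : NonUnitalSubalgebra k B} (hD : IsSUnital D)
    (U : PartialMultiplier B) {x : B} (hx : x ∈ U.rho.source) :
    U.rho x ∈ mulSpan D.toSubmodule ⊤ ↔ x ∈ mulSpan D.toSubmodule ⊤ := by
  rw [hD.mem_mulSpan_top_right, hD.mem_mulSpan_top_right]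
  exact exists_congr fun e => U.mul_rho_eq_iff hx

theorem lam_mem_mulSpan_iff {k B : Type*} [CommRing k] [NonUnitalRing B] [Module k B]
    [IsScalarTower k B B] {D : NonUnitalSubalgebra k B} (hD : IsSUnital D)
    (U : PartialMultiplier B) {x : B} (hx : x ∈ U.lam.source) :
    U.lam x ∈ mulSpan ⊤ D.toSubmodule ↔ x ∈ mulSpan ⊤ D.toSubmodule := by
  rw [hD.mem_mulSpan_top_left, hD.mem_mulSpan_top_left]
  exact exists_congr fun e => U.lam_mul_eq_iff hx

variable {k G B : Type*} [CommRing k] [Group G] [DecidableEq G] [NonUnitalRing B]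
  [Module k B] [IsScalarTower k B B] {𝓑 : GroupGrading k G B}

/-- The partial multiplier `U` of the graded algebra `B` acts like a homogeneous unit of
degree `g`. -/
structure HasDegree (U : PartialMultiplier B) (𝓑 : GroupGrading k G B) (g : G) : Prop where
  rho_source : U.rho.source = 𝓑.leftIdeal g
  rho_target : U.rho.target = 𝓑.leftIdeal g⁻¹
  lam_source : U.lam.source = 𝓑.rightIdeal g⁻¹
  lam_target : U.lam.target = 𝓑.rightIdeal g
  rho_mem : ∀ d ∈ 𝓑.D g, U.rho d ∈ 𝓑.comp g
  rho_symm_mem : ∀ d ∈ 𝓑.D g⁻¹, U.rho.symm d ∈ 𝓑.comp g⁻¹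
  lam_mem : ∀ d ∈ 𝓑.D g⁻¹, U.lam d ∈ 𝓑.comp g
  lam_symm_mem : ∀ d ∈ 𝓑.D g, U.lam.symm d ∈ 𝓑.comp g⁻¹

namespace HasDegree

theorem inv {U : PartialMultiplier B} {g : G} (hU : U.HasDegree 𝓑 g) : U⁻¹.HasDegree 𝓑 g⁻¹ where
  rho_source := hU.rho_target
  rho_target := (inv_inv g).symm ▸ hU.rho_source
  lam_source := (inv_inv g).symm ▸ hU.lam_target
  lam_target := hU.lam_source
  rho_mem := hU.rho_symm_mem
  rho_symm_mem := (inv_inv g).symm ▸ hU.rho_mem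
  lam_mem := (inv_inv g).symm ▸ hU.lam_symm_mem
  lam_symm_mem := (inv_inv g).symm ▸ hU.lam_mem

variable [SMulCommClass k B B] (H : 𝓑.NearlyEpsilonStrong) {U : PartialMultiplier B} {g h : G}
  {b : B}

include H

theorem mem_rho_source_iff (hU : U.HasDegree 𝓑 g) (hb : b ∈ 𝓑.comp h) :
    b ∈ U.rho.source ↔ b ∈ 𝓑.rightIdeal (h * g) := by
  rw [hU.rho_source, SetLike.mem_coe, H.mem_leftIdeal_iff_mem_rightIdeal g hb]

theorem mem_lam_source_iff (hU : U.HasDegree 𝓑 g) (hb : b ∈ 𝓑.comp h) :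
    b ∈ U.lam.source ↔ b ∈ 𝓑.leftIdeal (g * h)⁻¹ := by
  rw [hU.lam_source, SetLike.mem_coe, H.mem_leftIdeal_iff_mem_rightIdeal _ hb, mul_inv_rev,
    mul_inv_cancel_left]

theorem rho_mem_comp (hU : U.HasDegree 𝓑 g) (hb : b ∈ 𝓑.comp h) (hbU : b ∈ U.rho.source) :
    U.rho b ∈ 𝓑.comp (h * g) := by
  obtain ⟨e, he⟩ := (H.sUnital g).mem_mulSpan_top_left.1 (hU.rho_source.le hbU)
  rw [← he, U.rho_mul b (hU.rho_source.ge (H.D_le_leftIdeal g e.2))]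
  exact 𝓑.mul_mem hb (hU.rho_mem e e.2)

theorem lam_mem_comp (hU : U.HasDegree 𝓑 g) (hb : b ∈ 𝓑.comp h) (hbU : b ∈ U.lam.source) :
    U.lam b ∈ 𝓑.comp (g * h) := by
  obtain ⟨e, he⟩ := (H.sUnital g⁻¹).mem_mulSpan_top_right.1 (hU.lam_source.le hbU)
  rw [← he, U.lam_mul b (hU.lam_source.ge (H.D_le_rightIdeal g⁻¹ e.2))]
  exact 𝓑.mul_mem (hU.lam_mem e e.2) hb

variable {U₁ U₂ U₃ : PartialMultiplier B} {g₁ g₂ g₃ : G}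

theorem rho_mul_mul_mapsTo (h₁ : U₁.HasDegree 𝓑 g₁) (h₂ : U₂.HasDegree 𝓑 g₂)
    (h₃ : U₃.HasDegree 𝓑 g₃) (hg : g₁ * g₂ * g₃ = 1) (hb₁ : b ∈ 𝓑.D g₁)
    (hb₂ : b ∈ 𝓑.D (g₁ * g₂)) :
    b ∈ (U₁ * U₂ * U₃).rho.source ∧ (U₁ * U₂ * U₃).rho b ∈ (𝓑.D g₁ ∩ 𝓑.D (g₁ * g₂) : Set B) := by
  have hb : b ∈ 𝓑.comp 1 := GroupGrading.mem_comp_one_of_mem_D hb₁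
  have hbU₁ : b ∈ U₁.rho.source := h₁.rho_source.ge (H.D_le_leftIdeal g₁ hb₁)
  have hc : U₁.rho b ∈ 𝓑.comp g₁ := one_mul g₁ ▸ h₁.rho_mem_comp H hb hbU₁
  have hcl : ∀ l, U₁.rho b ∈ 𝓑.rightIdeal l ↔ b ∈ 𝓑.rightIdeal l := fun l =>
    U₁.rho_mem_mulSpan_iff (H.sUnital l) hbU₁
  have hcU₂ : U₁.rho b ∈ U₂.rho.source :=
    (h₂.mem_rho_source_iff H hc).2 ((hcl _).2 (H.D_le_rightIdeal _ hb₂))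
  have hd : U₂.rho (U₁.rho b) ∈ 𝓑.comp (g₁ * g₂) := h₂.rho_mem_comp H hc hcU₂
  have hdl : ∀ l, U₂.rho (U₁.rho b) ∈ 𝓑.rightIdeal l ↔ b ∈ 𝓑.rightIdeal l := fun l =>
    (U₂.rho_mem_mulSpan_iff (H.sUnital l) hcU₂).trans (hcl l)
  have hdU₃ : U₂.rho (U₁.rho b) ∈ U₃.rho.source := by
    rw [h₃.mem_rho_source_iff H hd, hg, hdl]
    exact H.comp_le_rightIdeal 1 hb
  have he : U₃.rho (U₂.rho (U₁.rho b)) ∈ 𝓑.comp 1 := hg ▸ h₃.rho_mem_comp H hd hdU₃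
  have hel : ∀ l, U₃.rho (U₂.rho (U₁.rho b)) ∈ 𝓑.D l ↔ b ∈ 𝓑.D l := fun l => by
    rw [H.mem_D_iff_mem_rightIdeal l he, H.mem_D_iff_mem_rightIdeal l hb, ← hdl]
    exact U₃.rho_mem_mulSpan_iff (H.sUnital l) hdU₃
  exact ⟨⟨⟨hbU₁, hcU₂⟩, hdU₃⟩, (hel _).2 hb₁, (hel _).2 hb₂⟩

theorem lam_mul_mul_mapsTo (h₁ : U₁.HasDegree 𝓑 g₁) (h₂ : U₂.HasDegree 𝓑 g₂)
    (h₃ : U₃.HasDegree 𝓑 g₃) (hg : g₁ * g₂ * g₃ = 1) (hb₁ : b ∈ 𝓑.D g₁)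
    (hb₂ : b ∈ 𝓑.D (g₁ * g₂)) :
    b ∈ (U₁ * U₂ * U₃).lam.source ∧ (U₁ * U₂ * U₃).lam b ∈ (𝓑.D g₁ ∩ 𝓑.D (g₁ * g₂) : Set B) := by
  have hg₃ : g₃⁻¹ = g₁ * g₂ := inv_eq_of_mul_eq_one_left hg
  have hg₁ : (g₂ * g₃)⁻¹ = g₁ := inv_eq_of_mul_eq_one_left (by rw [← mul_assoc, hg])
  have hb : b ∈ 𝓑.comp 1 := GroupGrading.mem_comp_one_of_mem_D hb₁
  have hbU₃ : b ∈ U₃.lam.source := h₃.lam_source.ge (H.D_le_rightIdeal _ (hg₃ ▸ hb₂))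
  have hc : U₃.lam b ∈ 𝓑.comp g₃ := mul_one g₃ ▸ h₃.lam_mem_comp H hb hbU₃
  have hcl : ∀ l, U₃.lam b ∈ 𝓑.leftIdeal l ↔ b ∈ 𝓑.leftIdeal l := fun l =>
    U₃.lam_mem_mulSpan_iff (H.sUnital l) hbU₃
  have hcU₂ : U₃.lam b ∈ U₂.lam.source := by
    rw [h₂.mem_lam_source_iff H hc, hg₁, hcl]
    exact H.D_le_leftIdeal _ hb₁
  have hd : U₂.lam (U₃.lam b) ∈ 𝓑.comp (g₂ * g₃) := h₂.lam_mem_comp H hc hcU₂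
  have hdl : ∀ l, U₂.lam (U₃.lam b) ∈ 𝓑.leftIdeal l ↔ b ∈ 𝓑.leftIdeal l := fun l =>
    (U₂.lam_mem_mulSpan_iff (H.sUnital l) hcU₂).trans (hcl l)
  have hdU₁ : U₂.lam (U₃.lam b) ∈ U₁.lam.source := by
    rw [h₁.mem_lam_source_iff H hd, ← mul_assoc, hg, hdl]
    exact inv_one (G := G) ▸ H.comp_le_leftIdeal 1 hb
  have he : U₁.lam (U₂.lam (U₃.lam b)) ∈ 𝓑.comp 1 := by
    have := h₁.lam_mem_comp H hd hdU₁
    rwa [← mul_assoc, hg] at this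
  have hel : ∀ l, U₁.lam (U₂.lam (U₃.lam b)) ∈ 𝓑.D l ↔ b ∈ 𝓑.D l := fun l => by
    rw [H.mem_D_iff_mem_leftIdeal l he, H.mem_D_iff_mem_leftIdeal l hb, ← hdl]
    exact U₁.lam_mem_mulSpan_iff (H.sUnital l) hdU₁
  exact ⟨⟨hbU₃, hcU₂, hdU₁⟩, (hel _).2 hb₁, (hel _).2 hb₂⟩

theorem preserves_mul_mul (h₁ : U₁.HasDegree 𝓑 g₁) (h₂ : U₂.HasDegree 𝓑 g₂)
    (h₃ : U₃.HasDegree 𝓑 g₃) (hg : g₁ * g₂ * g₃ = 1) :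
    (U₁ * U₂ * U₃).Preserves (𝓑.D g₁ ∩ 𝓑.D (g₁ * g₂)) where
  subset_rho_source _ hb := (h₁.rho_mul_mul_mapsTo H h₂ h₃ hg hb.1 hb.2).1
  subset_lam_source _ hb := (h₁.lam_mul_mul_mapsTo H h₂ h₃ hg hb.1 hb.2).1
  rho_mapsTo _ hb := (h₁.rho_mul_mul_mapsTo H h₂ h₃ hg hb.1 hb.2).2
  lam_mapsTo _ hb := (h₁.lam_mul_mul_mapsTo H h₂ h₃ hg hb.1 hb.2).2

end HasDegree

end PartialMultiplier

namespace GroupGrading.LocalUnits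

variable {k G B : Type*} [CommRing k] [Group G] [DecidableEq G] [NonUnitalRing B]
  [Module k B] [IsScalarTower k B B] [SMulCommClass k B B] {𝓑 : GroupGrading k G B}
  (T : 𝓑.LocalUnits)

theorem u_hasDegree (g : G) : (T.u g).HasDegree 𝓑 g where
  rho_source := T.rho_source g
  rho_target := T.rho_target g
  lam_source := T.lam_source g
  lam_target := T.lam_target g
  rho_mem d hd := T.rho_coe ⟨d, hd⟩ ▸ (T.ψ g ⟨d, hd⟩).2
  rho_symm_mem d hd := by
    obtain ⟨s, hs, hds⟩ := T.exists_mul_eq_mul_ψ' hd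
    have hsg : s ∈ 𝓑.leftIdeal g := inv_inv g ▸ T.comp_le_leftIdeal g⁻¹ hs
    rw [← (T.rho_eq_iff hsg (T.D_le_leftIdeal g⁻¹ hd)).2 hds]
    exact ((T.rho g).left_inv (T.mem_rho_source.2 hsg)).symm ▸ hs
  lam_mem d hd := T.lam_coe ⟨d, hd⟩ ▸ (T.ψ' g ⟨d, hd⟩).2
  lam_symm_mem d hd := by
    obtain ⟨s, hs, hds⟩ := T.exists_mul_eq_ψ_mul hd
    have hsg : s ∈ 𝓑.rightIdeal g⁻¹ := T.comp_le_rightIdeal g⁻¹ hs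
    rw [← (T.lam_eq_iff hsg (T.D_le_rightIdeal g hd)).2 hds]
    exact ((T.lam g).left_inv (T.mem_lam_source.2 hsg)).symm ▸ hs

end GroupGrading.LocalUnits

namespace GroupGrading

variable {k G B : Type*} [CommRing k] [Group G] [DecidableEq G] [NonUnitalRing B]
  [Module k B] [IsScalarTower k B B] [SMulCommClass k B B] {𝓑 : GroupGrading k G B}

/-- The inclusion in `B` of the product of two of the ideals `D_g` of `B_1`. -/
def mulInclusion (𝓑 : GroupGrading k G B) (g h : G) : ↥(𝓑.ideal g * 𝓑.ideal h) →ₙ* B where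
  toFun x := ((x : 𝓑.one) : B)
  map_mul' _ _ := rfl

theorem mulInclusion_injective (g h : G) : Function.Injective (𝓑.mulInclusion g h) :=
  Subtype.val_injective.comp Subtype.val_injective

theorem NearlyEpsilonStrong.range_mulInclusion (H : 𝓑.NearlyEpsilonStrong) (g h : G) :
    Set.range (𝓑.mulInclusion g h) = (𝓑.D g ∩ 𝓑.D h : Set B) := by
  ext x
  constructor
  · rintro ⟨y, rfl⟩
    exact H.mem_ideal_mul_iff.1 y.2
  · intro hx
    exact ⟨⟨⟨x, mem_comp_one_of_mem_D hx.1⟩, H.mem_ideal_mul_iff.2 hx⟩, rfl⟩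

namespace LocalUnits

variable (T : 𝓑.LocalUnits)

/-- The homogeneous unit `u_g u_h u_{gh}⁻¹` of degree `1`. -/
noncomputable def twist (g h : G) : PartialMultiplier B := T.u g * T.u h * (T.u (g * h))⁻¹

theorem twist_preserves (g h : G) : (T.twist g h).Preserves (𝓑.D g ∩ 𝓑.D (g * h)) :=
  (T.u_hasDegree g).preserves_mul_mul T.toNearlyEpsilonStrong (T.u_hasDegree h)
    (T.u_hasDegree (g * h)).inv (mul_inv_cancel _)

theorem twist_inv_preserves (g h : G) : (T.twist g h)⁻¹.Preserves (𝓑.D g ∩ 𝓑.D (g * h)) := by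
  have hp := (T.u_hasDegree (g * h)).preserves_mul_mul T.toNearlyEpsilonStrong
    (T.u_hasDegree h).inv (T.u_hasDegree g).inv (by group)
  rw [mul_inv_cancel_right, Set.inter_comm] at hp
  rwa [twist, PartialMultiplier.mul_inv_rev, PartialMultiplier.mul_inv_rev, inv_inv, ← mul_assoc]

theorem exists_w (g h : G) : ∃ w : (Multiplier k ↥(𝓑.ideal g * 𝓑.ideal (g * h)))ˣ,
    (∀ x, ((w.val.R x : 𝓑.one) : B) = (T.twist g h).rho ((x : 𝓑.one) : B)) ∧
      ∀ x, ((w.val.L x : 𝓑.one) : B) = (T.twist g h).lam ((x : 𝓑.one) : B) :=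
  PartialMultiplier.Preserves.exists_unit
    ((T.isSUnital_ideal g).algIdeal_mul (T.isSUnital_ideal (g * h)))
    (mulInclusion_injective g (g * h)) (T.range_mulInclusion g (g * h) ▸ T.twist_preserves g h)
    (T.range_mulInclusion g (g * h) ▸ T.twist_inv_preserves g h)

/-- The invertible multiplier `u_g u_h u_{gh}⁻¹` of `D_g D_{gh}`. -/
noncomputable def w (g h : G) : (Multiplier k ↥(𝓑.ideal g * 𝓑.ideal (g * h)))ˣ :=
  (T.exists_w g h).choose

theorem coe_w_R (g h : G) (x : ↥(𝓑.ideal g * 𝓑.ideal (g * h))) :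
    (((T.w g h).val.R x : 𝓑.one) : B) = (T.twist g h).rho ((x : 𝓑.one) : B) :=
  (T.exists_w g h).choose_spec.1 x

theorem coe_w_L (g h : G) (x : ↥(𝓑.ideal g * 𝓑.ideal (g * h))) :
    (((T.w g h).val.L x : 𝓑.one) : B) = (T.twist g h).lam ((x : 𝓑.one) : B) :=
  (T.exists_w g h).choose_spec.2 x

theorem rho_injOn {g : G} {x y : B} (hx : x ∈ 𝓑.leftIdeal g) (hy : y ∈ 𝓑.leftIdeal g)
    (h : T.rho g x = T.rho g y) : x = y :=
  (T.rho g).injOn (T.mem_rho_source.2 hx) (T.mem_rho_source.2 hy) h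

theorem rho_mem_leftIdeal {g h : G} {x : B} (hg : x ∈ 𝓑.D g) (hgh : x ∈ 𝓑.D (g * h)) :
    T.rho g x ∈ 𝓑.leftIdeal h :=
  T.mem_rho_source.1 ((T.twist_preserves g h).subset_rho_source ⟨hg, hgh⟩).1.2

theorem rho_lam_comm (U : PartialMultiplier B) {g : G} {x : B} (hx : x ∈ U.lam.source)
    (hxg : x ∈ 𝓑.leftIdeal g) : T.rho g (U.lam x) = U.lam (T.rho g x) := by
  obtain ⟨e, he⟩ := (T.sUnital g).mem_mulSpan_top_left.1 hxg
  exact U.rho_lam_comm (T.u g) hx (T.mem_rho_source.2 (T.D_le_leftIdeal g e.2)) he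

theorem rho_twist {g h : G} {x : B} (hg : x ∈ 𝓑.D g) (hgh : x ∈ 𝓑.D (g * h)) :
    T.rho (g * h) ((T.twist g h).rho x) = T.rho h (T.rho g x) :=
  (T.rho (g * h)).right_inv ((T.twist_preserves g h).subset_rho_source ⟨hg, hgh⟩).2

theorem twist_lam_lam {g h : G} {x : B} (hx : x ∈ 𝓑.rightIdeal (g * h)⁻¹) :
    (T.twist g h).lam (T.lam (g * h) x) = T.lam g (T.lam h x) :=
  congrArg (T.lam g ∘ T.lam h) ((T.lam (g * h)).left_inv (T.mem_lam_source.2 hx))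

/-- The isomorphism `a ↦ u_g a u_g⁻¹` from `D_{g⁻¹}` onto `D_g`. -/
noncomputable def θ (g : G) : 𝓑.ideal g⁻¹ ≃ₗ[k] 𝓑.ideal g :=
  (𝓑.idealEquiv g⁻¹).trans <| (T.ψ' g).trans <| (T.ψ g).symm.trans (𝓑.idealEquiv g).symm

theorem rho_θ (g : G) (a : 𝓑.ideal g⁻¹) :
    T.rho g ((T.θ g a : 𝓑.one) : B) = T.lam g ((a : 𝓑.one) : B) := by
  calc T.rho g ((T.θ g a : 𝓑.one) : B)
      = T.ψ g ((T.ψ g).symm (T.ψ' g (𝓑.idealEquiv g⁻¹ a))) := T.rho_coe _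
    _ = T.ψ' g (𝓑.idealEquiv g⁻¹ a) := by rw [LinearEquiv.apply_symm_apply]
    _ = T.lam g ((a : 𝓑.one) : B) := (T.lam_coe _).symm

theorem θ_mem_D_iff {g h : G} (a : 𝓑.ideal g⁻¹) :
    ((T.θ g a : 𝓑.one) : B) ∈ 𝓑.D (g * h) ↔ ((a : 𝓑.one) : B) ∈ 𝓑.D h := by
  have hθ : ((T.θ g a : 𝓑.one) : B) ∈ (T.rho g).source :=
    T.mem_rho_source.2 (T.D_le_leftIdeal g (T.θ g a).2)
  have ha : ((a : 𝓑.one) : B) ∈ (T.lam g).source :=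
    T.mem_lam_source.2 (T.D_le_rightIdeal g⁻¹ a.2)
  have hau : T.lam g ((a : 𝓑.one) : B) ∈ 𝓑.comp g := (T.u_hasDegree g).lam_mem _ a.2
  calc ((T.θ g a : 𝓑.one) : B) ∈ 𝓑.D (g * h)
      ↔ ((T.θ g a : 𝓑.one) : B) ∈ 𝓑.rightIdeal (g * h) :=
        T.mem_D_iff_mem_rightIdeal _ (T.θ g a : 𝓑.one).2
    _ ↔ T.rho g ((T.θ g a : 𝓑.one) : B) ∈ 𝓑.rightIdeal (g * h) :=
        ((T.u g).rho_mem_mulSpan_iff (T.sUnital _) hθ).symm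
    _ ↔ T.lam g ((a : 𝓑.one) : B) ∈ 𝓑.leftIdeal h := by
        rw [T.rho_θ, T.mem_leftIdeal_iff_mem_rightIdeal h hau]
    _ ↔ ((a : 𝓑.one) : B) ∈ 𝓑.leftIdeal h := (T.u g).lam_mem_mulSpan_iff (T.sUnital h) ha
    _ ↔ ((a : 𝓑.one) : B) ∈ 𝓑.D h := (T.mem_D_iff_mem_leftIdeal h (a : 𝓑.one).2).symm

theorem θ_mul (g : G) (a b : 𝓑.ideal g⁻¹) : T.θ g (a * b) = T.θ g a * T.θ g b := by
  have hθa := T.D_le_leftIdeal g (T.θ g a).2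
  have hθb := T.D_le_leftIdeal g (T.θ g b).2
  refine Subtype.ext <| Subtype.ext <| T.rho_injOn (T.D_le_leftIdeal g (T.θ g (a * b)).2)
    (T.D_le_leftIdeal g (T.θ g a * T.θ g b).2) ?_
  calc T.rho g ((T.θ g (a * b) : 𝓑.one) : B)
      = T.lam g (((a : 𝓑.one) : B) * ((b : 𝓑.one) : B)) := T.rho_θ g (a * b)
    _ = T.rho g ((T.θ g a : 𝓑.one) : B) * ((b : 𝓑.one) : B) := by
        rw [T.lam_mul _ (T.D_le_rightIdeal g⁻¹ a.2), T.rho_θ]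
    _ = ((T.θ g a : 𝓑.one) : B) * T.rho g ((T.θ g b : 𝓑.one) : B) := by
        rw [T.rho_mul_eq_mul_lam hθa (T.D_le_rightIdeal g⁻¹ b.2), T.rho_θ]
    _ = T.rho g (((T.θ g a : 𝓑.one) : B) * ((T.θ g b : 𝓑.one) : B)) :=
        (T.rho_mul _ hθb).symm

theorem θ_one (a : 𝓑.ideal (1 : G)⁻¹) : (T.θ 1 a : 𝓑.one) = a := by
  have ha : ((a : 𝓑.one) : B) ∈ 𝓑.rightIdeal 1 := T.comp_le_rightIdeal 1 (a : 𝓑.one).2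
  have h := T.rho_θ 1 a
  rw [T.rho_one (T.D_le_leftIdeal 1 (T.θ 1 a).2), T.lam_one ha] at h
  exact Subtype.ext h

theorem θ_image (g h : G) :
    (fun a : 𝓑.ideal g⁻¹ => (T.θ g a : 𝓑.one)) '' {a | (a : 𝓑.one) ∈ 𝓑.ideal g⁻¹ * 𝓑.ideal h} =
      (𝓑.ideal g * 𝓑.ideal (g * h) : AlgIdeal k 𝓑.one) := by
  ext x
  constructor
  · rintro ⟨a, ha, rfl⟩
    exact T.mem_ideal_mul_iff.2 ⟨(T.θ g a).2, (T.θ_mem_D_iff a).2 (T.mem_ideal_mul_iff.1 ha).2⟩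
  · intro hx
    obtain ⟨hg, hgh⟩ := T.mem_ideal_mul_iff.1 hx
    obtain ⟨a, ha⟩ := (T.θ g).surjective ⟨x, hg⟩
    have hax : (T.θ g a : 𝓑.one) = x := congrArg Subtype.val ha
    exact ⟨a, T.mem_ideal_mul_iff.2 ⟨a.2, (T.θ_mem_D_iff a).1 (hax ▸ hgh)⟩, hax⟩

/-- The partial action `θ_g(a) = u_g a u_g⁻¹` of `G` on `B_1`, before twisting. -/
noncomputable def partialActionData : PartialActionData k G 𝓑.one where
  D := 𝓑.ideal
  θ := T.θ
  θ_mul := T.θ_mul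
  D_idem _ := SetLike.ext fun _ => T.mem_ideal_mul_iff.trans (and_self_iff)
  D_comm _ _ := SetLike.ext fun _ => by
    rw [T.mem_ideal_mul_iff, T.mem_ideal_mul_iff, and_comm]
  D_one a := T.D_one.ge a.2
  θ_one := T.θ_one
  θ_image := T.θ_image

theorem twist_one_left {g : G} {x : B} (h₁ : x ∈ 𝓑.D 1) (hg : x ∈ 𝓑.D (1 * g)) :
    (T.twist 1 g).rho x = x := by
  refine T.rho_injOn (T.D_le_leftIdeal _ ((T.twist_preserves 1 g).rho_mapsTo ⟨h₁, hg⟩).2)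
    (T.D_le_leftIdeal _ hg) ?_
  rw [T.rho_twist h₁ hg, T.rho_one (T.D_le_leftIdeal 1 h₁), one_mul]

theorem twist_one_right {g : G} {x : B} (hg : x ∈ 𝓑.D g) (hg₁ : x ∈ 𝓑.D (g * 1)) :
    (T.twist g 1).rho x = x := by
  refine T.rho_injOn (T.D_le_leftIdeal _ ((T.twist_preserves g 1).rho_mapsTo ⟨hg, hg₁⟩).2)
    (T.D_le_leftIdeal _ hg₁) ?_
  rw [T.rho_twist hg hg₁, T.rho_one (T.rho_mem_leftIdeal hg hg₁), mul_one]

theorem w_eq_one {g h : G}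
    (H : ∀ x : B, x ∈ 𝓑.D g → x ∈ 𝓑.D (g * h) → (T.twist g h).rho x = x) : T.w g h = 1 := by
  refine Units.ext <| Multiplier.eq_one_of_R_eq
    ((T.isSUnital_ideal g).algIdeal_mul (T.isSUnital_ideal (g * h))) fun x =>
      Subtype.ext <| Subtype.ext ?_
  obtain ⟨hg, hgh⟩ := T.mem_ideal_mul_iff.1 x.2
  exact (T.coe_w_R g h x).trans (H _ hg hgh)

theorem twist_θ_θ {g h : G} {a : 𝓑.one} (ha : a ∈ 𝓑.ideal h⁻¹) (ha' : a ∈ 𝓑.ideal (g * h)⁻¹)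
    (hθa : (T.θ h ⟨a, ha⟩ : 𝓑.one) ∈ 𝓑.ideal g⁻¹) :
    (T.twist g h).rho ((T.θ g ⟨T.θ h ⟨a, ha⟩, hθa⟩ : 𝓑.one) : B) =
      (T.twist g h).lam ((T.θ (g * h) ⟨a, ha'⟩ : 𝓑.one) : B) := by
  set b := T.θ h ⟨a, ha⟩ with hb
  set y := T.θ g ⟨b, hθa⟩ with hy
  set z := T.θ (g * h) ⟨a, ha'⟩ with hz
  have hygh : ((y : 𝓑.one) : B) ∈ 𝓑.D (g * h) := (T.θ_mem_D_iff _).2 b.2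
  have hzg : ((z : 𝓑.one) : B) ∈ 𝓑.D g := by
    have := (T.θ_mem_D_iff (g := g * h) (h := h⁻¹) ⟨a, ha'⟩).2 ha
    rwa [mul_inv_cancel_right] at this
  have hbg : ((b : 𝓑.one) : B) ∈ (T.lam g).source :=
    T.mem_lam_source.2 (T.D_le_rightIdeal _ hθa)
  refine T.rho_injOn (T.D_le_leftIdeal _ ((T.twist_preserves g h).rho_mapsTo ⟨y.2, hygh⟩).2)
    (T.D_le_leftIdeal _ ((T.twist_preserves g h).lam_mapsTo ⟨hzg, z.2⟩).2) ?_
  calc T.rho (g * h) ((T.twist g h).rho ((y : 𝓑.one) : B))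
      = T.rho h (T.lam g ((b : 𝓑.one) : B)) := by rw [T.rho_twist y.2 hygh, hy, T.rho_θ]
    _ = T.lam g (T.rho h ((b : 𝓑.one) : B)) := T.rho_lam_comm (T.u g) hbg (T.D_le_leftIdeal h b.2)
    _ = T.lam g (T.lam h (a : B)) := by rw [hb, T.rho_θ]
    _ = (T.twist g h).lam (T.lam (g * h) (a : B)) :=
        (T.twist_lam_lam (T.D_le_rightIdeal _ ha')).symm
    _ = (T.twist g h).lam (T.rho (g * h) ((z : 𝓑.one) : B)) := by rw [hz, T.rho_θ]
    _ = T.rho (g * h) ((T.twist g h).lam ((z : 𝓑.one) : B)) :=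
        (T.rho_lam_comm _ ((T.twist_preserves g h).subset_lam_source ⟨hzg, z.2⟩)
          (T.D_le_leftIdeal _ z.2)).symm

theorem twist_rho_mem_D {g h : G} (l : G) {x : B} (hg : x ∈ 𝓑.D g) (hgh : x ∈ 𝓑.D (g * h))
    (hl : x ∈ 𝓑.D l) : (T.twist g h).rho x ∈ 𝓑.D l := by
  have hx := (T.twist_preserves g h).rho_mapsTo ⟨hg, hgh⟩
  refine (T.mem_D_iff_mem_rightIdeal l (mem_comp_one_of_mem_D hx.1)).2 ?_
  exact ((T.twist g h).rho_mem_mulSpan_iff (T.sUnital l)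
    ((T.twist_preserves g h).subset_rho_source ⟨hg, hgh⟩)).2 (T.D_le_rightIdeal l hl)

theorem twist_cocycle {g h t : G} {a b : 𝓑.ideal g⁻¹} (hah : ((a : 𝓑.one) : B) ∈ 𝓑.D h)
    (hat : ((a : 𝓑.one) : B) ∈ 𝓑.D (h * t))
    (hab : ((b : 𝓑.one) : B) = (T.twist h t).rho ((a : 𝓑.one) : B)) :
    (T.twist g (h * t)).rho ((T.θ g b : 𝓑.one) : B) =
      (T.twist (g * h) t).rho ((T.twist g h).rho ((T.θ g a : 𝓑.one) : B)) := by
  set x := ((a : 𝓑.one) : B)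
  set y := ((T.θ g a : 𝓑.one) : B) with hy
  have hbt : ((b : 𝓑.one) : B) ∈ 𝓑.D (h * t) :=
    hab ▸ ((T.twist_preserves h t).rho_mapsTo ⟨hah, hat⟩).2
  have hθbt : ((T.θ g b : 𝓑.one) : B) ∈ 𝓑.D (g * (h * t)) := (T.θ_mem_D_iff b).2 hbt
  have hyg : y ∈ 𝓑.D g := (T.θ g a).2
  have hyh : y ∈ 𝓑.D (g * h) := (T.θ_mem_D_iff a).2 hah
  have hyt : y ∈ 𝓑.D (g * h * t) := mul_assoc g h t ▸ (T.θ_mem_D_iff a).2 hat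
  have hwyh := T.twist_rho_mem_D (g * h) hyg hyh hyh
  have hwyt := T.twist_rho_mem_D (g * h * t) hyg hyh hyt
  have hxg : x ∈ (T.u g).lam.source := T.mem_lam_source.2 (T.D_le_rightIdeal _ a.2)
  have hxhg : T.rho h x ∈ (T.u g).lam.source := T.mem_lam_source.2 <|
    ((T.u h).rho_mem_mulSpan_iff (T.sUnital _)
      (T.mem_rho_source.2 (T.D_le_leftIdeal h hah))).2 (T.D_le_rightIdeal _ a.2)
  refine T.rho_injOn (g := g * (h * t))
    (T.D_le_leftIdeal _ (T.twist_rho_mem_D _ (T.θ g b).2 hθbt hθbt))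
    (T.D_le_leftIdeal _ (mul_assoc g h t ▸ T.twist_rho_mem_D _ hwyh hwyt hwyt)) ?_
  calc T.rho (g * (h * t)) ((T.twist g (h * t)).rho ((T.θ g b : 𝓑.one) : B))
      = T.rho (h * t) (T.lam g ((T.twist h t).rho x)) := by
        rw [T.rho_twist (T.θ g b).2 hθbt, T.rho_θ, hab]
    _ = T.lam g (T.rho t (T.rho h x)) := by
        rw [← T.rho_twist hah hat, ← hab]
        exact T.rho_lam_comm (T.u g) (T.mem_lam_source.2 (T.D_le_rightIdeal _ b.2))
          (T.D_le_leftIdeal _ hbt)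
    _ = T.rho t (T.lam g (T.rho h x)) :=
        (T.rho_lam_comm (T.u g) hxhg (T.rho_mem_leftIdeal hah hat)).symm
    _ = T.rho t (T.rho h (T.lam g x)) :=
        congrArg (T.rho t) (T.rho_lam_comm (T.u g) hxg (T.D_le_leftIdeal h hah)).symm
    _ = T.rho (g * h * t) ((T.twist (g * h) t).rho ((T.twist g h).rho y)) := by
        rw [T.rho_twist hwyh hwyt, T.rho_twist hyg hyh, hy, T.rho_θ]
    _ = T.rho (g * (h * t)) ((T.twist (g * h) t).rho ((T.twist g h).rho y)) := by
        rw [mul_assoc]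

/-- The twisted partial action `θ_g(a) = u_g a u_g⁻¹`, `w_{g,h} = u_g u_h u_{gh}⁻¹` of `G` on
`B_1`. -/
noncomputable def twistedPartialAction : TwistedPartialAction k G 𝓑.one where
  toPartialActionData := T.partialActionData
  w := T.w
  θ_θ g h a ha := by
    have ha' := T.partialActionData.mem_inv_mul ha
    have hθa := T.partialActionData.θ_mem_inv ha
    have hθθa : (T.θ g ⟨T.θ h ⟨a, AlgIdeal.mem_left_of_mem_mul ha⟩, hθa⟩ : 𝓑.one) ∈
        𝓑.ideal g * 𝓑.ideal (g * h) :=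
      T.mem_ideal_mul_iff.2 ⟨(T.θ g _).2, (T.θ_mem_D_iff _).2 (T.θ h _).2⟩
    refine congrArg Subtype.val
      (Multiplier.inv_R_eq_of_R_eq (w := T.w g h) (a := ⟨_, hθθa⟩) ?_).symm
    have hwL := T.coe_w_L g h ⟨_, T.partialActionData.θ_mul_mem ha⟩
    exact Subtype.ext <| Subtype.ext <|
      (T.coe_w_R g h ⟨_, hθθa⟩).trans ((T.twist_θ_θ _ ha' hθa).trans hwL.symm)
  w_one_left _ := T.w_eq_one fun _ => T.twist_one_left
  w_one_right _ := T.w_eq_one fun _ => T.twist_one_right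
  cocycle g h t a ha := by
    have hag : (a : B) ∈ 𝓑.D g⁻¹ := T.partialActionData.mem_inv ha
    obtain ⟨hah, hat⟩ := T.mem_ideal_mul_iff.1 (T.partialActionData.mem_mul_two ha)
    have hwa := T.coe_w_R h t ⟨a, T.partialActionData.mem_mul_two ha⟩
    have hwθa := T.coe_w_R g h ⟨_, T.partialActionData.θ_mem_mul ha⟩
    have hl := T.coe_w_R g (h * t) ⟨_, T.partialActionData.θ_R_mem (T.w h t).val ha⟩
    have hr := T.coe_w_R (g * h) t ⟨_, T.partialActionData.R_θ_mem (T.w g h).val ha⟩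
    have hc := T.twist_cocycle (a := ⟨a, hag⟩)
      (b := ⟨_, T.partialActionData.mem_inv (T.partialActionData.R_mem_mul (T.w h t).val ha)⟩)
      hah hat hwa
    exact Subtype.ext <| hl.trans <| hc.trans <|
      (congrArg (T.twist (g * h) t).rho hwθa.symm).trans hr.symm

open TwistedPartialAction

theorem rho_homogMul (g h : G) (a : 𝓑.ideal g) (b : 𝓑.ideal h) :
    T.rho (g * h) ((T.twistedPartialAction.homogMul g h a b : 𝓑.one) : B) =
      T.rho g ((a : 𝓑.one) : B) * T.rho h ((b : 𝓑.one) : B) := by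
  set p := T.twistedPartialAction.preMul g h a b
  set c := (T.θ g).symm a with hc
  obtain ⟨hpg, hpgh⟩ := T.mem_ideal_mul_iff.1 p.2
  calc T.rho (g * h) ((T.twistedPartialAction.homogMul g h a b : 𝓑.one) : B)
      = T.rho (g * h) ((T.twist g h).rho ((p : 𝓑.one) : B)) :=
        congrArg (T.rho (g * h)) (T.coe_w_R g h p)
    _ = T.rho h (T.rho g ((p : 𝓑.one) : B)) := T.rho_twist hpg hpgh
    _ = T.rho h (T.lam g (((c : 𝓑.one) : B) * ((b : 𝓑.one) : B))) :=
        congrArg (T.rho h) (T.rho_θ g _)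
    _ = T.lam g ((c : 𝓑.one) : B) * T.rho h ((b : 𝓑.one) : B) := by
        rw [T.lam_mul _ (T.D_le_rightIdeal g⁻¹ c.2), T.rho_mul _ (T.D_le_leftIdeal h b.2)]
    _ = T.rho g ((a : 𝓑.one) : B) * T.rho h ((b : 𝓑.one) : B) := by
        rw [← T.rho_θ, hc, LinearEquiv.apply_symm_apply]

/-- The map `a δ_g ↦ a u_g` from the crossed product to `B`. -/
noncomputable def crossedProductEquiv : T.twistedPartialAction.CrossedProduct ≃ₗ[k] B :=
  (DFinsupp.mapRange.linearEquiv fun g => (𝓑.idealEquiv g).trans (T.ψ g)).trans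
    (LinearEquiv.ofBijective (DirectSum.coeLinearMap 𝓑.comp) 𝓑.isInternal)

theorem crossedProductEquiv_single (g : G) (a : 𝓑.ideal g) :
    T.crossedProductEquiv (CrossedProduct.single T.twistedPartialAction g a) =
      T.ψ g (𝓑.idealEquiv g a) := by
  change DirectSum.coeLinearMap 𝓑.comp (DFinsupp.mapRange.linearEquiv
    (fun g => (𝓑.idealEquiv g).trans (T.ψ g)) (DFinsupp.single g a)) = _
  rw [DFinsupp.mapRange.linearEquiv_apply, DFinsupp.mapRange_single]
  exact DirectSum.coeLinearMap_lof _ _ _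

theorem crossedProductEquiv_single_eq_rho (g : G) (a : 𝓑.ideal g) :
    T.crossedProductEquiv (CrossedProduct.single T.twistedPartialAction g a) =
      T.rho g ((a : 𝓑.one) : B) :=
  (T.crossedProductEquiv_single g a).trans (T.rho_coe (𝓑.idealEquiv g a)).symm

theorem crossedProductEquiv_mul (x y : T.twistedPartialAction.CrossedProduct) :
    T.crossedProductEquiv (x * y) = T.crossedProductEquiv x * T.crossedProductEquiv y := by
  have h : (CrossedProduct.mulHom T.twistedPartialAction).compr₂ T.crossedProductEquiv.toLinearMap =
      (LinearMap.mul k B).compl₁₂ T.crossedProductEquiv.toLinearMap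
        T.crossedProductEquiv.toLinearMap := by
    refine DirectSum.linearMap_ext k fun g => LinearMap.ext fun a =>
      DirectSum.linearMap_ext k fun h => LinearMap.ext fun b => ?_
    calc T.crossedProductEquiv (CrossedProduct.single T.twistedPartialAction g a *
          CrossedProduct.single T.twistedPartialAction h b)
        = T.rho (g * h) ((T.twistedPartialAction.homogMul g h a b : 𝓑.one) : B) := by
          rw [CrossedProduct.single_mul_single]
          exact T.crossedProductEquiv_single_eq_rho (g * h) _
      _ = T.rho g ((a : 𝓑.one) : B) * T.rho h ((b : 𝓑.one) : B) := T.rho_homogMul g h a b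
      _ = T.crossedProductEquiv (CrossedProduct.single T.twistedPartialAction g a) *
          T.crossedProductEquiv (CrossedProduct.single T.twistedPartialAction h b) := by
          rw [← T.crossedProductEquiv_single_eq_rho g a, ← T.crossedProductEquiv_single_eq_rho h b]
  exact LinearMap.congr_fun₂ h x y

include T in
theorem isCrossedProduct : 𝓑.IsCrossedProduct := by
  refine ⟨T.twistedPartialAction, T.crossedProductEquiv.symm, fun x y => ?_, fun g => ?_⟩
  · rw [LinearEquiv.symm_apply_eq, crossedProductEquiv_mul, LinearEquiv.apply_symm_apply,
      LinearEquiv.apply_symm_apply]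
  · ext x
    constructor
    · rintro ⟨b, hb, rfl⟩
      refine ⟨(𝓑.idealEquiv g).symm ((T.ψ g).symm ⟨b, hb⟩), ?_⟩
      refine (T.crossedProductEquiv.eq_symm_apply).2 ((T.crossedProductEquiv_single g _).trans ?_)
      rw [LinearEquiv.apply_symm_apply, LinearEquiv.apply_symm_apply]
    · rintro ⟨a, rfl⟩
      exact ⟨T.ψ g (𝓑.idealEquiv g a), (T.ψ g _).2,
        T.crossedProductEquiv.symm_apply_eq.2 (T.crossedProductEquiv_single g a).symm⟩

end LocalUnits

theorem NearlyEpsilonStrong.exists_localUnits (H : 𝓑.NearlyEpsilonStrong)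
    (hψ : ∀ g : G, ∃ (ψ : 𝓑.D g ≃ₗ[k] 𝓑.comp g) (ψ' : 𝓑.D g⁻¹ ≃ₗ[k] 𝓑.comp g),
      ∀ (d : 𝓑.D g) (d' : 𝓑.D g⁻¹), (ψ d : B) * d' = d * ψ' d') :
    Nonempty 𝓑.LocalUnits := by
  have hone : ∀ g : G, g = 1 → (𝓑.D g).toSubmodule = 𝓑.comp 1 := fun g hg => hg ▸ H.D_one
  have hψ_one : ∀ g : G, ∃ (ψ : 𝓑.D g ≃ₗ[k] 𝓑.comp g) (ψ' : 𝓑.D g⁻¹ ≃ₗ[k] 𝓑.comp g),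
      (∀ (d : 𝓑.D g) (d' : 𝓑.D g⁻¹), (ψ d : B) * d' = d * ψ' d') ∧
      (g = 1 → (∀ d : 𝓑.D g, (ψ d : B) = d) ∧ ∀ d : 𝓑.D g⁻¹, (ψ' d : B) = d) := by
    intro g
    obtain rfl | hg := eq_or_ne g 1
    · exact ⟨LinearEquiv.ofEq _ _ H.D_one, LinearEquiv.ofEq _ _ (hone 1⁻¹ inv_one),
        fun _ _ => rfl, fun _ => ⟨fun _ => rfl, fun _ => rfl⟩⟩
    · obtain ⟨ψ, ψ', hψψ'⟩ := hψ g
      exact ⟨ψ, ψ', hψψ', fun h => absurd h hg⟩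
  choose ψ ψ' balanced normalized using hψ_one
  exact ⟨⟨H, ψ, ψ', balanced, (normalized 1 rfl).1, (normalized 1 rfl).2⟩⟩

end GroupGrading

theorem AlgIdeal.eq_top_of_forall_mul_mem {k A : Type*} [CommRing k] [NonUnitalRing A] [Module k A]
    [IsScalarTower k A A] [SMulCommClass k A A] {I : AlgIdeal k A} (hI : I * I = I)
    {N : Submodule k I} (h : ∀ a b : I, a * b ∈ N) : N = ⊤ := by
  have hle : (I * I).toSubmodule ≤ N.map (SMulMemClass.subtype I) :=
    mulSpan_le.2 fun a ha b hb => ⟨⟨a, ha⟩ * ⟨b, hb⟩, h _ _, rfl⟩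
  refine Submodule.eq_top_iff'.2 fun a => ?_
  obtain ⟨b, hbN, hba⟩ := hle (hI.symm ▸ a.2 : (a : A) ∈ I * I)
  exact Subtype.ext hba ▸ hbN

namespace TwistedPartialAction

variable {k G A : Type*} [CommRing k] [Group G] [NonUnitalRing A] [Module k A]
  [IsScalarTower k A A] [SMulCommClass k A A] (Θ : TwistedPartialAction k G A)

theorem coe_homogMul_one_left (g : G) (a : Θ.D 1) (b : Θ.D g) :
    (Θ.homogMul 1 g a b : A) = a * b := by
  have hθ : (((Θ.θ 1).symm a : Θ.D (1 : G)⁻¹) : A) = a := by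
    rw [← Θ.θ_one, LinearEquiv.apply_symm_apply]
  calc (Θ.homogMul 1 g a b : A)
      = (Θ.w 1 g).val.R (Θ.preMul 1 g a b) := rfl
    _ = Θ.preMul 1 g a b := by rw [Θ.w_one_left]; rfl
    _ = ((Θ.θ 1).symm a : A) * b := Θ.θ_one _
    _ = a * b := by rw [hθ]

theorem coe_homogMul_one_right (g : G) (a : Θ.D g) (b : Θ.D 1) :
    (Θ.homogMul g 1 a b : A) =
      Θ.θ g ⟨((Θ.θ g).symm a : A) * b, AlgIdeal.mul_mem_right _ _ ((Θ.θ g).symm a).2⟩ := by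
  calc (Θ.homogMul g 1 a b : A)
      = (Θ.w g 1).val.R (Θ.preMul g 1 a b) := rfl
    _ = Θ.preMul g 1 a b := by rw [Θ.w_one_right]; rfl

theorem mem_mul_mul_inv {g : G} {a : A} (ha : a ∈ Θ.D g) : a ∈ Θ.D g * Θ.D (g * g⁻¹) := by
  have hgg : a ∈ Θ.D g * Θ.D g := (Θ.D_idem g).symm ▸ ha
  refine mulSpan_mono le_rfl (fun x _ => ?_) hgg
  exact (mul_inv_cancel g).symm ▸ Θ.D_one x

/-- The map `x ↦ θ_g(x) w_{g,g⁻¹}` from `D_{g⁻¹}` onto `D_g`; it sends `x y` to the coefficient of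
`(θ_g(x) δ_g) (y δ_{g⁻¹})`. -/
def θw (g : G) : Θ.D g⁻¹ →ₗ[k] ↥(Θ.D g * Θ.D (g * g⁻¹)) where
  toFun x := (Θ.w g g⁻¹).val.R ⟨Θ.θ g x, Θ.mem_mul_mul_inv (Θ.θ g x).2⟩
  map_add' x y := by
    rw [← map_add]
    exact congrArg (Θ.w g g⁻¹).val.R
      (Subtype.ext (congrArg (fun z : Θ.D g => (z : A)) (map_add (Θ.θ g) x y)))
  map_smul' c x := by
    rw [RingHom.id_apply, ← map_smul]
    exact congrArg (Θ.w g g⁻¹).val.R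
      (Subtype.ext (congrArg (fun z : Θ.D g => (z : A)) (map_smul (Θ.θ g) c x)))

theorem θw_surjective (g : G) : Function.Surjective (Θ.θw g) := fun b => by
  obtain ⟨a, rfl⟩ := Multiplier.R_surjective (Θ.w g g⁻¹) b
  obtain ⟨x, hx⟩ := (Θ.θ g).surjective ⟨a, AlgIdeal.mem_left_of_mem_mul a.2⟩
  exact ⟨x, congrArg (Θ.w g g⁻¹).val.R
    (Subtype.ext (congrArg (fun z : Θ.D g => (z : A)) hx))⟩

theorem θw_mul (g : G) (x y : Θ.D g⁻¹) :
    (Θ.θw g (x * y) : A) = Θ.homogMul g g⁻¹ (Θ.θ g x) y := by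
  have hpre : Θ.preMul g g⁻¹ (Θ.θ g x) y =
      ⟨Θ.θ g (x * y), Θ.mem_mul_mul_inv (Θ.θ g (x * y)).2⟩ := by
    refine Subtype.ext (congrArg (fun z => (Θ.θ g z : A)) (Subtype.ext ?_))
    exact congrArg (fun z : Θ.D g⁻¹ => (z : A) * y) ((Θ.θ g).symm_apply_apply x)
  exact congrArg (fun z => ((Θ.w g g⁻¹).val.R z : A)) hpre.symm

end TwistedPartialAction

namespace GroupGrading

variable {k G B : Type*} [CommRing k] [Group G] [DecidableEq G] [NonUnitalRing B]
  [Module k B] [IsScalarTower k B B] [SMulCommClass k B B]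

/-- Linear isomorphisms `σ_g : D_g → B_g` turning the product of the crossed product by `Θ` into
that of `B`: a graded isomorphism from the crossed product to `B`, with `σ_g(a)` the image of
`a δ_g`. -/
structure CrossedProductModel (𝓑 : GroupGrading k G B)
    (Θ : TwistedPartialAction k G 𝓑.one) where
  σ : ∀ g : G, Θ.D g ≃ₗ[k] 𝓑.comp g
  σ_mul : ∀ (g h : G) (a : Θ.D g) (b : Θ.D h), (σ g a : B) * σ h b = σ (g * h) (Θ.homogMul g h a b)

variable {𝓑 : GroupGrading k G B}

open TwistedPartialAction in
theorem IsCrossedProduct.exists_model (h : 𝓑.IsCrossedProduct) :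
    ∃ Θ : TwistedPartialAction k G 𝓑.one, Nonempty (𝓑.CrossedProductModel Θ) := by
  obtain ⟨Θ, φ, hφ, hr⟩ := h
  have hinj (g : G) : Function.Injective (φ.symm.toLinearMap ∘ₗ CrossedProduct.single Θ g) :=
    φ.symm.injective.comp (DFinsupp.single_injective (β := fun g => Θ.D g) (i := g))
  have hrange (g : G) : LinearMap.range (φ.symm.toLinearMap ∘ₗ CrossedProduct.single Θ g) =
      𝓑.comp g := by
    rw [LinearMap.range_comp, ← hr g, ← Submodule.map_comp, LinearEquiv.symm_comp, Submodule.map_id]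
  refine ⟨Θ, ⟨fun g => (LinearEquiv.ofInjective _ (hinj g)).trans
    (LinearEquiv.ofEq _ _ (hrange g)), fun g h a b => φ.injective ?_⟩⟩
  calc φ (φ.symm (CrossedProduct.single Θ g a) * φ.symm (CrossedProduct.single Θ h b))
      = CrossedProduct.single Θ g a * CrossedProduct.single Θ h b := by
        rw [hφ, φ.apply_symm_apply, φ.apply_symm_apply]
    _ = φ (φ.symm (CrossedProduct.single Θ (g * h) (Θ.homogMul g h a b))) := by
        rw [φ.apply_symm_apply, CrossedProduct.single_mul_single]

namespace CrossedProductModel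

variable {Θ : TwistedPartialAction k G 𝓑.one} (M : 𝓑.CrossedProductModel Θ)

theorem σ_congr {g h : G} (hgh : g = h) {a : Θ.D g} {b : Θ.D h} (hab : (a : 𝓑.one) = b) :
    (M.σ g a : B) = M.σ h b := by
  subst hgh
  rw [Subtype.ext hab]

/-- The embedding `a ↦ a δ_1` of the coefficient algebra `B_1`, followed by the isomorphism of the
crossed product with `B`. It need not be the inclusion. -/
def τ : 𝓑.one →ₗ[k] B where
  toFun a := M.σ 1 ⟨a, Θ.D_one a⟩
  map_add' a b := congrArg Subtype.val (map_add (M.σ 1) ⟨a, Θ.D_one a⟩ ⟨b, Θ.D_one b⟩)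
  map_smul' c a := congrArg Subtype.val (map_smul (M.σ 1) c ⟨a, Θ.D_one a⟩)

theorem τ_injective : Function.Injective M.τ := fun _ _ h =>
  congrArg Subtype.val ((M.σ 1).injective (Subtype.ext h))

theorem τ_mul_σ (g : G) (a : 𝓑.one) (b : Θ.D g) :
    M.τ a * M.σ g b = M.σ g ⟨a * b, AlgIdeal.mul_mem_left _ a b.2⟩ :=
  (M.σ_mul 1 g ⟨a, Θ.D_one a⟩ b).trans
    (M.σ_congr (one_mul g) (Θ.coe_homogMul_one_left g ⟨a, Θ.D_one a⟩ b))

theorem τ_mul (a b : 𝓑.one) : M.τ (a * b) = M.τ a * M.τ b :=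
  (M.τ_mul_σ 1 a ⟨b, Θ.D_one b⟩).symm

theorem σ_mul_τ (g : G) (a : Θ.D g) (b : 𝓑.one) :
    M.σ g a * M.τ b = M.σ g (Θ.θ g
      ⟨((Θ.θ g).symm a : 𝓑.one) * b, AlgIdeal.mul_mem_right _ _ ((Θ.θ g).symm a).2⟩) :=
  (M.σ_mul g 1 a ⟨b, Θ.D_one b⟩).trans
    (M.σ_congr (mul_one g) (Θ.coe_homogMul_one_right g a ⟨b, Θ.D_one b⟩))

theorem σ_θ_mul_τ (g : G) (a b : Θ.D g⁻¹) :
    M.σ g (Θ.θ g a) * M.τ b = M.σ g (Θ.θ g (a * b)) := by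
  rw [M.σ_mul_τ]
  refine congrArg (fun z => (M.σ g (Θ.θ g z) : B)) (Subtype.ext ?_)
  exact congrArg (fun z : Θ.D g⁻¹ => (z : 𝓑.one) * (b : 𝓑.one)) ((Θ.θ g).symm_apply_apply a)

theorem σ_mul_σ_inv (g : G) (a : Θ.D g) (b : Θ.D g⁻¹) :
    (M.σ g a : B) * M.σ g⁻¹ b = M.τ (Θ.homogMul g g⁻¹ a b) :=
  (M.σ_mul g g⁻¹ a b).trans (M.σ_congr (mul_inv_cancel g) rfl)

theorem map_τ (g : G) : (Θ.D g).toSubmodule.map M.τ = mulSpan (𝓑.comp g) (𝓑.comp g⁻¹) := by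
  apply le_antisymm
  · rintro _ ⟨a, ha, rfl⟩
    obtain ⟨x, hx⟩ := Θ.θw_surjective g ⟨a, Θ.mem_mul_mul_inv ha⟩
    have htop : (mulSpan (𝓑.comp g) (𝓑.comp g⁻¹)).comap
        (M.τ ∘ₗ SMulMemClass.subtype _ ∘ₗ Θ.θw g) = ⊤ := by
      refine AlgIdeal.eq_top_of_forall_mul_mem (Θ.D_idem g⁻¹) fun x y => ?_
      change M.τ (Θ.θw g (x * y)) ∈ mulSpan (𝓑.comp g) (𝓑.comp g⁻¹)
      rw [Θ.θw_mul, ← M.σ_mul_σ_inv]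
      exact mul_mem_mulSpan (M.σ g _).2 (M.σ g⁻¹ y).2
    have hxτ : M.τ (Θ.θw g x) ∈ mulSpan (𝓑.comp g) (𝓑.comp g⁻¹) := Submodule.eq_top_iff'.1 htop x
    rwa [hx] at hxτ
  · refine mulSpan_le.2 fun x hx y hy => ?_
    obtain ⟨a, ha⟩ := (M.σ g).surjective ⟨x, hx⟩
    obtain ⟨b, hb⟩ := (M.σ g⁻¹).surjective ⟨y, hy⟩
    refine ⟨Θ.homogMul g g⁻¹ a b, ?_, by rw [← M.σ_mul_σ_inv, ha, hb]⟩
    exact AlgIdeal.mem_left_of_mem_mul ((Θ.w g g⁻¹).val.R (Θ.preMul g g⁻¹ a b)).2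

theorem τ_mem {g : G} {a : 𝓑.one} (ha : a ∈ Θ.D g) : M.τ a ∈ mulSpan (𝓑.comp g) (𝓑.comp g⁻¹) :=
  (M.map_τ g).le ⟨a, ha, rfl⟩

include M in
theorem symmetric (g : G) :
    mulSpan (mulSpan (𝓑.comp g) (𝓑.comp g⁻¹)) (𝓑.comp g) = 𝓑.comp g := by
  refine le_antisymm (mulSpan_le.2 fun x hx y hy =>
    mul_mem_of_eq (𝓑.mulSpan_inv_le_one g hx) hy (one_mul g)) fun x hx => ?_
  obtain ⟨a, ha⟩ := (M.σ g).surjective ⟨x, hx⟩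
  have htop : (mulSpan (mulSpan (𝓑.comp g) (𝓑.comp g⁻¹)) (𝓑.comp g)).comap
      ((𝓑.comp g).subtype ∘ₗ (M.σ g).toLinearMap) = ⊤ := by
    refine AlgIdeal.eq_top_of_forall_mul_mem (Θ.D_idem g) fun a b => ?_
    exact (M.τ_mul_σ g a b).subst (mul_mem_mulSpan (M.τ_mem a.2) (M.σ g b).2)
  have hσa : (M.σ g a : B) ∈ mulSpan (mulSpan (𝓑.comp g) (𝓑.comp g⁻¹)) (𝓑.comp g) :=
    Submodule.eq_top_iff'.1 htop a
  rwa [ha] at hσa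

/-- The isomorphism `a ↦ a δ_1` from `D g` onto `B_g B_{g⁻¹}`. -/
noncomputable def δ (g : G) : Θ.D g ≃ₗ[k] 𝓑.D g :=
  (Submodule.equivMapOfInjective M.τ M.τ_injective (Θ.D g).toSubmodule).trans
    (LinearEquiv.ofEq _ _ (M.map_τ g))

theorem coe_δ (g : G) (a : Θ.D g) : (M.δ g a : B) = M.τ a := rfl

theorem δ_mul (g : G) (a b : Θ.D g) : M.δ g (a * b) = M.δ g a * M.δ g b :=
  Subtype.ext (M.τ_mul a b)

include M in
theorem exists_balanced (g : G) :
    ∃ (ψ : 𝓑.D g ≃ₗ[k] 𝓑.comp g) (ψ' : 𝓑.D g⁻¹ ≃ₗ[k] 𝓑.comp g),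
      (∀ d x : 𝓑.D g, (ψ (d * x) : B) = d * ψ x) ∧
      (∀ x d : 𝓑.D g⁻¹, (ψ' (x * d) : B) = ψ' x * d) ∧
      ∀ (d : 𝓑.D g) (d' : 𝓑.D g⁻¹), (ψ d : B) * d' = d * ψ' d' := by
  set ψ := (M.δ g).symm.trans (M.σ g)
  set ψ' := (M.δ g⁻¹).symm.trans ((Θ.θ g).trans (M.σ g))
  have ψ_δ (a : Θ.D g) : ψ (M.δ g a) = M.σ g a :=
    congrArg (M.σ g) ((M.δ g).symm_apply_apply a)
  have ψ'_δ (a : Θ.D g⁻¹) : ψ' (M.δ g⁻¹ a) = M.σ g (Θ.θ g a) :=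
    congrArg (fun z => M.σ g (Θ.θ g z)) ((M.δ g⁻¹).symm_apply_apply a)
  refine ⟨ψ, ψ', fun d x => ?_, fun x d => ?_, fun d d' => ?_⟩
  · obtain ⟨a, rfl⟩ := (M.δ g).surjective d
    obtain ⟨b, rfl⟩ := (M.δ g).surjective x
    rw [← M.δ_mul, ψ_δ, ψ_δ, M.coe_δ]
    exact (M.τ_mul_σ g a b).symm
  · obtain ⟨a, rfl⟩ := (M.δ g⁻¹).surjective x
    obtain ⟨b, rfl⟩ := (M.δ g⁻¹).surjective d
    rw [← M.δ_mul, ψ'_δ, ψ'_δ, M.coe_δ, M.σ_θ_mul_τ]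
  · obtain ⟨a, rfl⟩ := (M.δ g).surjective d
    obtain ⟨b, rfl⟩ := (M.δ g⁻¹).surjective d'
    obtain ⟨c, rfl⟩ := (Θ.θ g).surjective a
    calc (ψ (M.δ g (Θ.θ g c)) : B) * M.δ g⁻¹ b
        = M.σ g (Θ.θ g (c * b)) := by rw [ψ_δ, M.coe_δ, M.σ_θ_mul_τ]
      _ = M.σ g (Θ.θ g c * Θ.θ g b) := by rw [Θ.θ_mul]
      _ = M.δ g (Θ.θ g c) * ψ' (M.δ g⁻¹ b) := by
          rw [ψ'_δ, M.coe_δ]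
          exact (M.τ_mul_σ g (Θ.θ g c) (Θ.θ g b)).symm

end CrossedProductModel

end GroupGrading

theorem theorem5p2 {k G B : Type*} [CommRing k] [Group G] [DecidableEq G] [NonUnitalRing B]
    [Module k B] [IsScalarTower k B B] [SMulCommClass k B B] (𝓑 : GroupGrading k G B)
    (hD : ∀ g : G, IsSUnital (𝓑.D g)) :
    𝓑.IsCrossedProduct ↔
      (∀ g : G, mulSpan (mulSpan (𝓑.comp g) (𝓑.comp g⁻¹)) (𝓑.comp g) = 𝓑.comp g) ∧
      ∀ g : G, ∃ (ψ : 𝓑.D g ≃ₗ[k] 𝓑.comp g) (ψ' : 𝓑.D g⁻¹ ≃ₗ[k] 𝓑.comp g),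
        (∀ d x : 𝓑.D g, (ψ (d * x) : B) = d * ψ x) ∧
        (∀ x d : 𝓑.D g⁻¹, (ψ' (x * d) : B) = ψ' x * d) ∧
        ∀ (d : 𝓑.D g) (d' : 𝓑.D g⁻¹), (ψ d : B) * d' = d * ψ' d' := by
  constructor
  · intro h
    obtain ⟨Θ, ⟨M⟩⟩ := h.exists_model
    exact ⟨M.symmetric, M.exists_balanced⟩
  · rintro ⟨symmetric, hψ⟩
    have H : 𝓑.NearlyEpsilonStrong := ⟨hD, symmetric⟩
    obtain ⟨T⟩ := H.exists_localUnits fun g =>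
      (hψ g).imp fun _ => Exists.imp fun _ h => h.2.2
    exact T.isCrossedProduct
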